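/- Let $E\neq\{0\}$ be a real or complex Hilbert space. Write $\mathrm{Sym}(E)$ for the bounded self-adjoint operators on $E$, $\mathcal P_0\subset \mathrm{Sym}(E)$ for the positive semidefinite invertible ones, and $\le$ for the Loewner order. For $X\in\mathrm{Sym}(E)$ and $Y\in\mathcal P_0$ put $M(X/Y)=\inf\{t\in\mathbb R: X\le tY\}$ and $m(X/Y)=\sup\{t\in\mathbb R: X\ge tY\}$; the Thompson metric on $\mathcal P_0$ is $d_T(P,Q)=\log\max\{M(P/Q),M(Q/P)\}$. Let $A$ (bounded operators) and $D,\Sigma$ (with values in $\mathrm{Sym}(E)$) be continuous and bounded functions of $t\in\mathbb R$, and consider on $\mathrm{Sym}(E)$ the Riccati equation $$\dot P(t)=A(t)'P(t)+P(t)A(t)+D(t)-P(t)\Sigma(t)P(t).$$ Let $M_s^t(P_0)$ be the value at time $t$ of the maximal solution with value $P_0$ at time $s$, and let $t_{\mathcal P_0}(s,P_0)$ be the first time at which this solution leaves $\mathcal P_0$, that is, the supremum of the $b>s$ such that it exists and stays in $\mathcal P_0$ on $[s,b)$. Call $\alpha\in\mathbb R$ an admissible rate if $$d_T(M_s^t(P_1),M_s^t(P_2))\le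 e^{-\alpha(t-s)}d_T(P_1,P_2)$$ for all $P_1,P_2\in\mathcal P_0$, all $s\ge 0$ and all $t$ with $s\le t<\min\{t_{\mathcal P_0}(s,P_1),t_{\mathcal P_0}(s,P_2)\}$. The contraction rate is the best (greatest) admissible rate, understood as the supremum in $[-\infty,+\infty]$ of the admissible rates. 1. The contraction rate equals $$\sup\{\beta\in\mathbb R:\ P\Sigma(t)P+D(t)\ge\beta P\ \text{ for all } t\ge 0 \text{ and all } P\in\mathcal P_0\}$$ (both being $-\infty$ if there is no such $\beta$); if such a $\beta$ exists, this supremum is finite and is itself the greatest admissible rate. 2. If $D(t)$ and $\Sigma(t)$ are positive semidefinite for all $t\ge 0$, then the contraction rate equals $$2\inf_{t\ge 0}\sqrt{m\big((\Sigma(t)^{1/2}D(t)\Sigma(t)^{1/2})/I\big)},$$ and this number is the greatest admissible rate. -/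

import Mathlib

open scoped InnerProductSpace

noncomputable section

namespace Riccati

section General

variable {X : Type*}

/-- `M(x/y) = inf {t ∈ ℝ : x ≤ t y}`. -/
def upperRatio [LE X] [SMul ℝ X] (x y : X) : ℝ := sInf {t : ℝ | x ≤ t • y}

/-- `m(x/y) = sup {t ∈ ℝ : t y ≤ x}`. -/
def lowerRatio [LE X] [SMul ℝ X] (x y : X) : ℝ := sSup {t : ℝ | t • y ≤ x}

/-- The Thompson part metric `d_T(x, y) = log (max (M(x/y), M(y/x)))`
(meaningful for `x`, `y` in the interior of the cone). -/
def thompsonDist [LE X] [SMul ℝ X] (x y : X) : ℝ :=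
  Real.log (max (upperRatio x y) (upperRatio y x))

variable [NormedAddCommGroup X] [NormedSpace ℝ X]

/-- `x` is a solution on `[s, b)`, with values in `𝒟`, of `x'(t) = φ(t, x(t))`
(the derivative is one-sided at the left end point `s`). -/
def IsSolution (φ : ℝ → X → X) (𝒟 : Set X) (s b : ℝ) (x : ℝ → X) : Prop :=
  ∀ t ∈ Set.Ico s b, x t ∈ 𝒟 ∧ HasDerivWithinAt x (φ t (x t)) (Set.Ico s b) t

open Classical in
/-- The flow `M_s^t(x₀)`: the value at time `t` of the solution in `𝒟` that starts from `x₀` at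
time `s`. The value is `0` if no such solution lives beyond time `t`. -/
def flow (φ : ℝ → X → X) (𝒟 : Set X) (s t : ℝ) (x₀ : X) : X :=
  if h : ∃ x : ℝ → X, (∃ b : ℝ, t < b ∧ IsSolution φ 𝒟 s b x) ∧ x s = x₀ then h.choose t else 0

/-- The first exit time `t_U(s, x₀) ∈ [-∞, +∞]`: the supremum of the times `b > s` such that the
solution in `𝒟` starting from `x₀` at time `s` exists and stays in `U` on `[s, b)`. -/
def exitTime (φ : ℝ → X → X) (𝒟 U : Set X) (s : ℝ) (x₀ : X) : EReal :=
  sSup {e : EReal | ∃ b : ℝ, e = (b : EReal) ∧ s < b ∧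
    ∃ x : ℝ → X, IsSolution φ 𝒟 s b x ∧ x s = x₀ ∧ ∀ t ∈ Set.Ico s b, x t ∈ U}

/-- The flow of `φ` satisfies, on `U` and for all starting times `s ≥ 0`,
`d_T(M_s^t(x₁), M_s^t(x₂)) ≤ exp(-α (t - s)) d_T(x₁, x₂)`
as long as both trajectories stay in `U`. -/
def ContractsAtRate [LE X] (φ : ℝ → X → X) (𝒟 U : Set X) (α : ℝ) : Prop :=
  ∀ x₁ ∈ U, ∀ x₂ ∈ U, ∀ s t : ℝ, 0 ≤ s → s ≤ t →
    (t : EReal) < min (exitTime φ 𝒟 U s x₁) (exitTime φ 𝒟 U s x₂) →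
      thompsonDist (flow φ 𝒟 s t x₁) (flow φ 𝒟 s t x₂) ≤
        Real.exp (-α * (t - s)) * thompsonDist x₁ x₂

/-- The best contraction rate of the flow on `U`, as an extended real number
(`-∞` if there is no admissible rate at all). -/
def bestContractionRate [LE X] (φ : ℝ → X → X) (𝒟 U : Set X) : EReal :=
  sSup ((fun α : ℝ => (α : EReal)) '' {α : ℝ | ContractsAtRate φ 𝒟 U α})

end General

section Operators

variable {𝕜 E : Type*} [RCLike 𝕜] [NormedAddCommGroup E] [InnerProductSpace 𝕜 E] [CompleteSpace E]

/-- The symmetric bounded operators. -/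
def symOps (𝕜 E : Type*) [RCLike 𝕜] [NormedAddCommGroup E] [InnerProductSpace 𝕜 E]
    [CompleteSpace E] : Set (E →L[𝕜] E) := {P | IsSelfAdjoint P}

/-- The positive semidefinite invertible bounded operators. -/
def posInvOps (𝕜 E : Type*) [RCLike 𝕜] [NormedAddCommGroup E] [InnerProductSpace 𝕜 E] :
    Set (E →L[𝕜] E) := {P | P.IsPositive ∧ IsUnit P}

open Classical in
/-- The positive semidefinite square root `T^{1/2}` of a positive semidefinite operator `T`
(with value `0` at operators that have none). -/
def opSqrt (T : E →L[𝕜] E) : E →L[𝕜] E :=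
  if h : ∃ R : E →L[𝕜] E, R.IsPositive ∧ R * R = T then h.choose else 0

/-- The right-hand side `φ(t, P) = A(t)' P + P A(t) + D(t) - P Σ(t) P` of the standard Riccati
differential equation. -/
def riccatiField (A D S : ℝ → E →L[𝕜] E) (t : ℝ) (P : E →L[𝕜] E) : E →L[𝕜] E :=
  ContinuousLinearMap.adjoint (A t) * P + P * A t + D t - P * S t * P

/-- The set of `β ∈ ℝ` with `P Σ(t) P + D(t) ≥ β P` for all `t ≥ 0` and all positive semidefinite
invertible `P`, in the Loewner order. -/
def riccatiRates [NormedSpace ℝ E] [IsScalarTower ℝ 𝕜 E] (D S : ℝ → E →L[𝕜] E) : Set ℝ :=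
  {β : ℝ | ∀ t : ℝ, 0 ≤ t → ∀ P ∈ posInvOps 𝕜 E, β • P ≤ P * S t * P + D t}

end Operators

end Riccati

end

open scoped InnerProductSpace

noncomputable section

namespace Riccati

open Set Filter Topology ContinuousLinearMap

section QuadraticForms

variable {𝕜 E : Type*} [RCLike 𝕜] [NormedAddCommGroup E] [InnerProductSpace 𝕜 E]

/-! ### Quadratic forms of operators -/

/-! The key fact is that the admissible rates are exactly the `β` in `riccatiRates`
(`contractsAtRate_iff`). The Riccati field `φ` fails to be homogeneous only through `D` and `PΣP`:
`φ(cP) = cφ(P) - (c-1)(D + cPΣP)`, and `A` drops out (`riccatiField_smul`).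

If `β` is in `riccatiRates`, applying its inequality to all multiples `τQ` and integrating in `τ`
makes `λ(t)Q(t)`, with `log λ(t) = e^{-β(t-s)}d`, a supersolution. Comparison for the Riccati
equation then carries an order bound `P ≤ e^d Q` forward at rate `β` (`quadForm_le_exp_mul`).
Conversely, contraction applied to the solutions starting from `cP` and `P` gives, by
differentiating at the initial time and then letting `c` decrease to `1`, the inequality for `P`
(`mem_riccatiRates_of_contractsAtRate`).

For positive semidefinite coefficients, write `R = Σ^{1/2}`. When `RDR ≥ (β/2)² I` with `β > 0`, the
inequality is a completed square (`rate_le_of_lowerBound`). The converse tests it at `P = (β/2)(Σ +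
εI)⁻¹` and lets `ε` tend to `0` (`lowerBound_of_rate`).

Order relations are read off quadratic forms throughout. Since the dimension may be infinite,
positivity of an invertible operator is used as a uniform lower bound on its form. -/

/-- The real quadratic form `x ↦ re ⟪T x, x⟫` of an operator `T`. -/
def quadForm (T : E →L[𝕜] E) (x : E) : ℝ := RCLike.re ⟪T x, x⟫_𝕜

@[simp] lemma quadForm_zero (x : E) : quadForm (0 : E →L[𝕜] E) x = 0 := by simp [quadForm]

@[simp] lemma quadForm_one (x : E) : quadForm (1 : E →L[𝕜] E) x = ‖x‖ ^ 2 := by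
  simp [quadForm]

@[simp] lemma quadForm_add (S T : E →L[𝕜] E) (x : E) :
    quadForm (S + T) x = quadForm S x + quadForm T x := by
  simp [quadForm, inner_add_left]

@[simp] lemma quadForm_sub (S T : E →L[𝕜] E) (x : E) :
    quadForm (S - T) x = quadForm S x - quadForm T x := by
  simp [quadForm, inner_sub_left]

lemma abs_quadForm_le (T : E →L[𝕜] E) (x : E) : |quadForm T x| ≤ ‖T‖ * ‖x‖ ^ 2 := by
  calc |quadForm T x| ≤ ‖⟪T x, x⟫_𝕜‖ := RCLike.abs_re_le_norm _
    _ ≤ ‖T x‖ * ‖x‖ := norm_inner_le_norm _ _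
    _ ≤ ‖T‖ * ‖x‖ * ‖x‖ := by gcongr; exact T.le_opNorm x
    _ = ‖T‖ * ‖x‖ ^ 2 := by ring

lemma quadForm_le (T : E →L[𝕜] E) (x : E) : quadForm T x ≤ ‖T‖ * ‖x‖ ^ 2 :=
  (le_abs_self _).trans (abs_quadForm_le T x)

lemma _root_.ContinuousLinearMap.IsPositive.quadForm_nonneg {T : E →L[𝕜] E} (hT : T.IsPositive)
    (x : E) : 0 ≤ quadForm T x := hT.re_inner_nonneg_left x

lemma neg_le_quadForm (T : E →L[𝕜] E) (x : E) : -(‖T‖ * ‖x‖ ^ 2) ≤ quadForm T x :=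
  neg_le_of_abs_le (abs_quadForm_le T x)

section RealScalars

variable [NormedSpace ℝ E] [IsScalarTower ℝ 𝕜 E]

lemma real_smul_eq (c : ℝ) (x : E) : c • x = (c : 𝕜) • x := by
  rw [← algebraMap_smul 𝕜 c x, RCLike.algebraMap_eq_ofReal]

lemma real_smul_op_eq (c : ℝ) (T : E →L[𝕜] E) : c • T = (c : 𝕜) • T := by
  ext x
  rw [smul_apply, smul_apply, real_smul_eq (𝕜 := 𝕜)]

@[simp] lemma quadForm_smul (c : ℝ) (T : E →L[𝕜] E) (x : E) :
    quadForm (c • T) x = c * quadForm T x := by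
  rw [real_smul_op_eq, quadForm, quadForm, smul_apply, inner_smul_left, RCLike.conj_ofReal,
    RCLike.re_ofReal_mul]

/-- The quadratic form at `x`, as a real linear functional. -/
def quadFormCLM (𝕜 : Type*) {E : Type*} [RCLike 𝕜] [NormedAddCommGroup E]
    [InnerProductSpace 𝕜 E] [NormedSpace ℝ E] [IsScalarTower ℝ 𝕜 E] (x : E) :
    (E →L[𝕜] E) →L[ℝ] ℝ :=
  LinearMap.mkContinuous
    { toFun := fun T => quadForm T x
      map_add' := fun S T => quadForm_add S T x
      map_smul' := fun c T => quadForm_smul c T x } (‖x‖ ^ 2)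
    (fun T => by simpa [mul_comm] using abs_quadForm_le T x)

@[simp] lemma quadFormCLM_apply (x : E) (T : E →L[𝕜] E) : quadFormCLM 𝕜 x T = quadForm T x := rfl

/-- The bounded operators as a normed algebra over the reals. -/
instance realNormedAlgebra : NormedAlgebra ℝ (E →L[𝕜] E) where
  norm_smul_le := norm_smul_le

end RealScalars

/-- The Cauchy-Schwarz inequality for positive operators. -/
lemma norm_apply_sq_le {T : E →L[𝕜] E} (hT : T.IsPositive) (x : E) :
    ‖T x‖ ^ 2 ≤ ‖T‖ * quadForm T x := by
  have hre : RCLike.re ⟪T (T x), x⟫_𝕜 = ‖T x‖ ^ 2 := by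
    rw [hT.inner_left_eq_inner_right, inner_self_eq_norm_sq]
  have key : ∀ c : ℝ, 0 ≤ quadForm T x + c * (2 * ‖T x‖ ^ 2) + c ^ 2 * quadForm T (T x) := by
    intro c
    have h := hT.quadForm_nonneg (x + (c : 𝕜) • T x)
    have h2 : RCLike.re ⟪T x, T x⟫_𝕜 = ‖T x‖ ^ 2 := inner_self_eq_norm_sq _
    have : quadForm T (x + (c : 𝕜) • T x) =
        quadForm T x + c * (2 * ‖T x‖ ^ 2) + c ^ 2 * quadForm T (T x) := by
      simp only [quadForm, map_add, map_smul, inner_add_left, inner_add_right, inner_smul_left,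
        inner_smul_right, RCLike.conj_ofReal, RCLike.re_ofReal_mul, h2, hre]
      ring
    rwa [this] at h
  have hq : quadForm T (T x) ≤ ‖T‖ * ‖T x‖ ^ 2 := quadForm_le T (T x)
  rcases eq_or_lt_of_le (norm_nonneg T) with h0 | h0
  · have : T = 0 := norm_eq_zero.1 h0.symm
    simp [this]
  -- This `c` minimises the quadratic in `c` once `quadForm T (T x)` is replaced by its bound `‖T‖ *
  -- ‖T x‖ ^ 2`.
  · have h := key (-(1 / ‖T‖))
    have h3 : (-(1 / ‖T‖)) ^ 2 * quadForm T (T x) ≤ (1 / ‖T‖) * ‖T x‖ ^ 2 := by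
      calc (-(1 / ‖T‖)) ^ 2 * quadForm T (T x)
          ≤ (-(1 / ‖T‖)) ^ 2 * (‖T‖ * ‖T x‖ ^ 2) := by gcongr
        _ = _ := by field_simp
    have h4 : (1 / ‖T‖) * ‖T x‖ ^ 2 ≤ quadForm T x := by linarith
    calc ‖T x‖ ^ 2 = ‖T‖ * ((1 / ‖T‖) * ‖T x‖ ^ 2) := by field_simp
      _ ≤ _ := by gcongr

lemma norm_one_sub_le {T : E →L[𝕜] E} (hT : T.IsPositive) (h1 : ‖T‖ ≤ 1) : ‖1 - T‖ ≤ 1 := by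
  refine opNorm_le_bound _ zero_le_one fun x => ?_
  rw [one_mul]
  refine le_of_sq_le_sq ?_ (norm_nonneg _)
  have h2 := norm_apply_sq_le hT x
  have h3 := hT.quadForm_nonneg x
  have h4 : ‖(1 - T) x‖ ^ 2 = ‖x‖ ^ 2 - 2 * quadForm T x + ‖T x‖ ^ 2 := by
    have h5 : RCLike.re ⟪x, T x⟫_𝕜 = quadForm T x := by
      rw [← hT.inner_left_eq_inner_right]; rfl
    rw [sub_apply, one_apply_eq_self, @norm_sub_sq 𝕜, h5]
  nlinarith

variable [CompleteSpace E]

lemma quadForm_conj (B T : E →L[𝕜] E) (x : E) :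
    quadForm (adjoint B * T * B) x = quadForm T (B x) := by
  simp [quadForm, adjoint_inner_left]

lemma quadForm_conj_selfAdjoint {B : E →L[𝕜] E} (hB : IsSelfAdjoint B) (T : E →L[𝕜] E) (x : E) :
    quadForm (B * T * B) x = quadForm T (B x) := by
  have := quadForm_conj B T x
  rwa [← star_eq_adjoint, hB.star_eq] at this

lemma isPositive_iff_quadForm {T : E →L[𝕜] E} (hT : IsSelfAdjoint T) :
    T.IsPositive ↔ ∀ x, 0 ≤ quadForm T x := by
  rw [isPositive_def', and_iff_right hT]; rfl

lemma le_iff_quadForm {S T : E →L[𝕜] E} (hS : IsSelfAdjoint S) (hT : IsSelfAdjoint T) :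
    S ≤ T ↔ ∀ x, quadForm S x ≤ quadForm T x := by
  rw [ContinuousLinearMap.le_def, isPositive_iff_quadForm (hT.sub hS)]
  simp

/-! ### Square roots -/

section RealScalars

variable [NormedSpace ℝ E] [IsScalarTower ℝ 𝕜 E]

instance realStarModule : StarModule ℝ (E →L[𝕜] E) where
  star_smul c T := by
    rw [real_smul_op_eq, real_smul_op_eq, star_smul]; simp

lemma isSelfAdjoint_smul {T : E →L[𝕜] E} (hT : IsSelfAdjoint T) (c : ℝ) :
    IsSelfAdjoint (c • T) := (IsSelfAdjoint.all c).smul hT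

/-- The iteration `Y ↦ (B + Y²) / 2`, whose limit is `1 - (1 - B)^{1/2}`. -/
def sqrtIter {R : Type*} [Ring R] [Module ℝ R] (B : R) : ℕ → R
  | 0 => 0
  | n + 1 => (1 / 2 : ℝ) • (B + sqrtIter B n * sqrtIter B n)

/-- The scalar iteration with `B = 1` is the majorant for every `B` of norm at most `1`: its
increments bound those of `sqrtIter B` and telescope to at most `1`. -/
lemma sqrtIter_real_mono_le (n : ℕ) :
    0 ≤ sqrtIter (1 : ℝ) n ∧ sqrtIter (1 : ℝ) n ≤ sqrtIter (1 : ℝ) (n + 1) ∧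
      sqrtIter (1 : ℝ) (n + 1) ≤ 1 := by
  induction n with
  | zero => norm_num [sqrtIter]
  | succ n ih =>
    obtain ⟨h0, h1, h2⟩ := ih
    have e : sqrtIter (1 : ℝ) (n + 1 + 1) =
        (1 + sqrtIter (1 : ℝ) (n + 1) * sqrtIter (1 : ℝ) (n + 1)) / 2 := by
      rw [sqrtIter, smul_eq_mul]; ring
    have e' : sqrtIter (1 : ℝ) (n + 1) = (1 + sqrtIter (1 : ℝ) n * sqrtIter (1 : ℝ) n) / 2 := by
      rw [sqrtIter, smul_eq_mul]; ring
    refine ⟨h0.trans h1, ?_, ?_⟩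
    · rw [e]; nlinarith
    · rw [e]; nlinarith

lemma sqrtIter_commute {R : Type*} [Ring R] [Algebra ℝ R] (B : R) (n : ℕ) :
    ∀ C : R, Commute C B → Commute C (sqrtIter B n) := by
  induction n with
  | zero => intro C _; simp [sqrtIter]
  | succ n ih =>
    intro C hC
    exact (hC.add_right ((ih C hC).mul_right (ih C hC))).smul_right _

lemma norm_sqrtIter_le {R : Type*} [NormedRing R] [NormedAlgebra ℝ R] {B : R} (hB : ‖B‖ ≤ 1)
    (n : ℕ) : ‖sqrtIter B n‖ ≤ sqrtIter (1 : ℝ) n := by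
  induction n with
  | zero => simp [sqrtIter]
  | succ n ih =>
    have h0 := (sqrtIter_real_mono_le n).1
    calc ‖sqrtIter B (n + 1)‖ ≤ (1 / 2) * (‖B‖ + ‖sqrtIter B n‖ * ‖sqrtIter B n‖) := by
          rw [sqrtIter, norm_smul]
          norm_num
          exact (norm_add_le _ _).trans (by gcongr; exact norm_mul_le _ _)
      _ ≤ (1 / 2) * (1 + sqrtIter (1 : ℝ) n * sqrtIter (1 : ℝ) n) := by gcongr
      _ = _ := by rw [sqrtIter, smul_eq_mul]

/-- Successive iterates commute, so a difference of squares factors as sum times difference, and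
both factors are dominated by their scalar counterparts. -/
lemma norm_sqrtIter_sub_le {R : Type*} [NormedRing R] [NormedAlgebra ℝ R] {B : R}
    (hB : ‖B‖ ≤ 1) (n : ℕ) :
    ‖sqrtIter B (n + 1) - sqrtIter B n‖ ≤ sqrtIter (1 : ℝ) (n + 1) - sqrtIter (1 : ℝ) n := by
  induction n with
  | zero =>
    have : ‖B‖ / 2 ≤ 1 / 2 := by linarith
    simpa [sqrtIter, norm_smul, div_eq_inv_mul] using this
  | succ n ih =>
    have hc : Commute (sqrtIter B (n + 1)) (sqrtIter B n) :=
      sqrtIter_commute B n _ (sqrtIter_commute B (n + 1) B (Commute.refl B)).symm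
    have e : sqrtIter B (n + 1 + 1) - sqrtIter B (n + 1) = (1 / 2 : ℝ) •
        ((sqrtIter B (n + 1) + sqrtIter B n) * (sqrtIter B (n + 1) - sqrtIter B n)) := by
      rw [← hc.mul_self_sub_mul_self_eq, sqrtIter]
      conv_lhs => rw [show sqrtIter B (n + 1) = (1 / 2 : ℝ) • (B + sqrtIter B n * sqrtIter B n)
        from rfl]
      rw [← smul_sub, add_sub_add_left_eq_sub]
      rfl
    have e' : sqrtIter (1 : ℝ) (n + 1 + 1) - sqrtIter (1 : ℝ) (n + 1) = (1 / 2) *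
        ((sqrtIter (1 : ℝ) (n + 1) + sqrtIter (1 : ℝ) n) *
          (sqrtIter (1 : ℝ) (n + 1) - sqrtIter (1 : ℝ) n)) := by
      have a1 : sqrtIter (1 : ℝ) (n + 1 + 1) =
        (1 / 2) * (1 + sqrtIter (1 : ℝ) (n + 1) * sqrtIter (1 : ℝ) (n + 1)) := by
        rw [sqrtIter, smul_eq_mul]
      have a2 : sqrtIter (1 : ℝ) (n + 1) =
        (1 / 2) * (1 + sqrtIter (1 : ℝ) n * sqrtIter (1 : ℝ) n) := by
        rw [sqrtIter, smul_eq_mul]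
      rw [a1]
      nth_rewrite 3 [a2]
      ring
    rw [e, e', norm_smul]
    have h0 := (sqrtIter_real_mono_le n).1
    have h1 := (sqrtIter_real_mono_le (n + 1)).1
    have hs : ‖sqrtIter B (n + 1) + sqrtIter B n‖ ≤ sqrtIter (1 : ℝ) (n + 1) + sqrtIter (1 : ℝ) n :=
      (norm_add_le _ _).trans (add_le_add (norm_sqrtIter_le hB _) (norm_sqrtIter_le hB _))
    rw [show ‖(1 / 2 : ℝ)‖ = 1 / 2 by norm_num]
    refine mul_le_mul_of_nonneg_left ((norm_mul_le _ _).trans ?_) (by norm_num)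
    exact mul_le_mul hs ih (norm_nonneg _) (by linarith)

lemma exists_sqrtIter_tendsto {R : Type*} [NormedRing R] [NormedAlgebra ℝ R] [CompleteSpace R]
    {B : R} (hB : ‖B‖ ≤ 1) : ∃ Y, Tendsto (sqrtIter B) atTop (𝓝 Y) := by
  have hsum : Summable fun n => sqrtIter (1 : ℝ) (n + 1) - sqrtIter (1 : ℝ) n := by
    refine summable_of_sum_range_le (c := 1)
      (fun n => sub_nonneg.2 (sqrtIter_real_mono_le n).2.1) fun n => ?_
    rw [Finset.sum_range_sub]
    have := sqrtIter_real_mono_le n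
    simp only [sqrtIter, sub_zero]
    linarith
  refine cauchySeq_tendsto_of_complete (cauchySeq_of_dist_le_of_summable _ (fun n => ?_) hsum)
  rw [dist_comm, dist_eq_norm]
  exact norm_sqrtIter_sub_le hB n

/-- A limit `Y` of the iteration for `B = 1 - T/c` satisfies `2Y = B + Y²`, that is `(1 - Y)² =
T/c`, and `‖Y‖ ≤ 1` makes `1 - Y` positive. Uniqueness of the root plays no role: any positive root
serves as `opSqrt`. -/
lemma exists_isPositive_mul_self_eq {T : E →L[𝕜] E} (hT : T.IsPositive) :
    ∃ R : E →L[𝕜] E, R.IsPositive ∧ R * R = T := by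
  have hc : 0 < ‖T‖ + 1 := by positivity
  set c : ℝ := ‖T‖ + 1 with hc_def
  have hTs : IsSelfAdjoint T := hT.isSelfAdjoint
  have hT' : (c⁻¹ • T).IsPositive := by
    rw [isPositive_iff_quadForm (isSelfAdjoint_smul hTs _)]
    intro x
    rw [quadForm_smul]
    exact mul_nonneg (by positivity) (hT.quadForm_nonneg x)
  have hT1 : ‖c⁻¹ • T‖ ≤ 1 := by
    rw [norm_smul, norm_inv, Real.norm_of_nonneg hc.le, inv_mul_le_iff₀ hc]
    linarith
  set B : E →L[𝕜] E := 1 - c⁻¹ • T with hB_def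
  have hB : ‖B‖ ≤ 1 := norm_one_sub_le hT' hT1
  have hBs : IsSelfAdjoint B := (IsSelfAdjoint.one _).sub hT'.isSelfAdjoint
  obtain ⟨Y, hY⟩ := exists_sqrtIter_tendsto hB
  have hiter : ∀ n, IsSelfAdjoint (sqrtIter B n) := by
    intro n
    induction n with
    | zero => exact IsSelfAdjoint.zero _
    | succ n ih =>
      refine isSelfAdjoint_smul (hBs.add ?_) _
      rw [isSelfAdjoint_iff, star_mul, ih.star_eq]
  have hYs : IsSelfAdjoint Y := by
    refine tendsto_nhds_unique ((continuous_star.tendsto Y).comp hY) (hY.congr fun n => ?_)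
    exact (hiter n).star_eq.symm
  have hY1 : ‖Y‖ ≤ 1 := le_of_tendsto hY.norm <| Eventually.of_forall fun n =>
    (norm_sqrtIter_le hB n).trans
      ((sqrtIter_real_mono_le n).2.1.trans (sqrtIter_real_mono_le n).2.2)
  have hfix : Y = (1 / 2 : ℝ) • (B + Y * Y) := by
    refine tendsto_nhds_unique ((tendsto_add_atTop_iff_nat 1).2 hY) ?_
    exact ((hY.mul hY).const_add B).const_smul (1 / 2 : ℝ)
  have hfix2 : Y + Y = B + Y * Y := by
    conv_lhs => rw [hfix]
    rw [← add_smul]; norm_num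
  refine ⟨Real.sqrt c • (1 - Y), ?_, ?_⟩
  · rw [isPositive_iff_quadForm (isSelfAdjoint_smul ((IsSelfAdjoint.one _).sub hYs) _)]
    intro x
    rw [quadForm_smul, quadForm_sub, quadForm_one]
    have h1 := quadForm_le Y x
    have h2 : ‖Y‖ * ‖x‖ ^ 2 ≤ 1 * ‖x‖ ^ 2 := by gcongr
    exact mul_nonneg (Real.sqrt_nonneg _) (by linarith)
  · rw [smul_mul_smul_comm, Real.mul_self_sqrt hc.le]
    have : (1 - Y) * (1 - Y) = c⁻¹ • T := by
      calc (1 - Y) * (1 - Y) = 1 - (Y + Y) + Y * Y := by noncomm_ring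
        _ = c⁻¹ • T := by rw [hfix2, hB_def]; abel
    rw [this, smul_inv_smul₀ hc.ne']

lemma opSqrt_spec {T : E →L[𝕜] E} (hT : T.IsPositive) :
    (opSqrt T).IsPositive ∧ opSqrt T * opSqrt T = T := by
  have h := exists_isPositive_mul_self_eq hT
  rw [opSqrt, dif_pos h]
  exact h.choose_spec

end RealScalars

end QuadraticForms

section ThompsonMetric

variable {𝕜 E : Type*} [RCLike 𝕜] [NormedAddCommGroup E] [InnerProductSpace 𝕜 E] [CompleteSpace E]

/-! ### The positive semidefinite invertible operators and the Thompson metric -/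

/-- Forward: `‖x‖ ≤ ‖P⁻¹‖ ‖P x‖`, and Cauchy-Schwarz bounds `‖P x‖²` by the form. Backward: a
coercive operator is invertible, as in Lax-Milgram. -/
lemma mem_posInvOps_iff {P : E →L[𝕜] E} :
    P ∈ posInvOps 𝕜 E ↔ IsSelfAdjoint P ∧ ∃ c : ℝ, 0 < c ∧ ∀ x, c * ‖x‖ ^ 2 ≤ quadForm P x := by
  constructor
  · rintro ⟨hP, u, rfl⟩
    refine ⟨hP.isSelfAdjoint, ?_⟩
    set P : E →L[𝕜] E := (u : E →L[𝕜] E)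
    set R : E →L[𝕜] E := ((u⁻¹ : (E →L[𝕜] E)ˣ) : E →L[𝕜] E)
    have hRP : ∀ x, R (P x) = x := fun x => by
      have h : R * P = 1 := u.inv_mul
      exact congrArg (fun T : E →L[𝕜] E => T x) h
    refine ⟨((‖P‖ + 1) * (‖R‖ + 1) ^ 2)⁻¹, by positivity, fun x => ?_⟩
    have h0 := hP.quadForm_nonneg x
    have h1 : ‖x‖ ≤ (‖R‖ + 1) * ‖P x‖ := by
      calc ‖x‖ = ‖R (P x)‖ := by rw [hRP]
        _ ≤ ‖R‖ * ‖P x‖ := R.le_opNorm _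
        _ ≤ _ := by gcongr; linarith
    rw [inv_mul_le_iff₀ (by positivity)]
    calc ‖x‖ ^ 2 ≤ ((‖R‖ + 1) * ‖P x‖) ^ 2 := by gcongr
      _ = (‖R‖ + 1) ^ 2 * ‖P x‖ ^ 2 := by ring
      _ ≤ (‖R‖ + 1) ^ 2 * (‖P‖ * quadForm P x) := by gcongr; exact norm_apply_sq_le hP x
      _ ≤ (‖R‖ + 1) ^ 2 * ((‖P‖ + 1) * quadForm P x) := by gcongr; linarith
      _ = _ := by ring
  · rintro ⟨hP, c, hc, h⟩
    refine ⟨(isPositive_iff_quadForm hP).2 fun x => le_trans (by positivity) (h x), ?_⟩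
    refine isUnit_of_forall_le_norm_inner_map P (c := ⟨c, hc.le⟩) hc fun x => ?_
    calc ‖x‖ ^ 2 * c = c * ‖x‖ ^ 2 := mul_comm _ _
      _ ≤ quadForm P x := h x
      _ ≤ _ := RCLike.re_le_norm _

lemma exists_pos_quadForm [Nontrivial E] {P : E →L[𝕜] E} (hP : P ∈ posInvOps 𝕜 E) :
    ∃ x, 0 < quadForm P x := by
  obtain ⟨_, d, hd, h⟩ := mem_posInvOps_iff.1 hP
  obtain ⟨x, hx⟩ := exists_ne (0 : E)
  exact ⟨x, lt_of_lt_of_le (by have := norm_pos_iff.2 hx; positivity) (h x)⟩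

variable [NormedSpace ℝ E] [IsScalarTower ℝ 𝕜 E]

lemma smul_mem_posInvOps {P : E →L[𝕜] E} (hP : P ∈ posInvOps 𝕜 E) {c : ℝ} (hc : 0 < c) :
    c • P ∈ posInvOps 𝕜 E := by
  obtain ⟨hs, d, hd, h⟩ := mem_posInvOps_iff.1 hP
  refine mem_posInvOps_iff.2 ⟨isSelfAdjoint_smul hs c, c * d, by positivity, fun x => ?_⟩
  rw [quadForm_smul, mul_assoc]
  exact mul_le_mul_of_nonneg_left (h x) hc.le

lemma smul_le_iff_quadForm {P Q : E →L[𝕜] E} (hP : IsSelfAdjoint P) (hQ : IsSelfAdjoint Q)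
    (c : ℝ) : P ≤ c • Q ↔ ∀ x, quadForm P x ≤ c * quadForm Q x := by
  rw [le_iff_quadForm hP (isSelfAdjoint_smul hQ c)]
  simp

/-- Nontriviality matters: on the zero space every real `t` would belong to the set. -/
lemma bddBelow_upperRatio_set [Nontrivial E] {P Q : E →L[𝕜] E} (hP : P ∈ posInvOps 𝕜 E)
    (hQ : Q ∈ posInvOps 𝕜 E) : BddBelow {t : ℝ | P ≤ t • Q} := by
  refine ⟨0, fun t ht => ?_⟩
  obtain ⟨x, hx⟩ := exists_pos_quadForm hP
  have h := (smul_le_iff_quadForm hP.1.isSelfAdjoint hQ.1.isSelfAdjoint t).1 ht x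
  have hq := hQ.1.quadForm_nonneg x
  by_contra! hneg
  nlinarith

lemma upperRatio_le [Nontrivial E] {P Q : E →L[𝕜] E} (hP : P ∈ posInvOps 𝕜 E)
    (hQ : Q ∈ posInvOps 𝕜 E) {t : ℝ} (h : ∀ x, quadForm P x ≤ t * quadForm Q x) :
    upperRatio P Q ≤ t :=
  csInf_le (bddBelow_upperRatio_set hP hQ)
    ((smul_le_iff_quadForm hP.1.isSelfAdjoint hQ.1.isSelfAdjoint t).2 h)

/-- The infimum is attained: the set is closed and bounded below, and coercivity of `Q` makes it
nonempty. -/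
lemma quadForm_le_upperRatio_mul [Nontrivial E] {P Q : E →L[𝕜] E} (hP : P ∈ posInvOps 𝕜 E)
    (hQ : Q ∈ posInvOps 𝕜 E) (x : E) : quadForm P x ≤ upperRatio P Q * quadForm Q x := by
  have hiff := smul_le_iff_quadForm hP.1.isSelfAdjoint hQ.1.isSelfAdjoint
  have hcl : IsClosed {t : ℝ | P ≤ t • Q} := by
    simp only [hiff, Set.ofPred_forall]
    exact isClosed_iInter fun y => isClosed_le continuous_const (by fun_prop)
  have hne : {t : ℝ | P ≤ t • Q}.Nonempty := by
    obtain ⟨_, d, hd, h⟩ := mem_posInvOps_iff.1 hQ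
    refine ⟨‖P‖ / d, (hiff _).2 fun y => ?_⟩
    calc quadForm P y ≤ ‖P‖ * ‖y‖ ^ 2 := quadForm_le P y
      _ = ‖P‖ / d * (d * ‖y‖ ^ 2) := by field_simp
      _ ≤ _ := by gcongr; exact h y
  exact (hiff _).1 (hcl.csInf_mem hne (bddBelow_upperRatio_set hP hQ)) x

lemma upperRatio_pos [Nontrivial E] {P Q : E →L[𝕜] E} (hP : P ∈ posInvOps 𝕜 E)
    (hQ : Q ∈ posInvOps 𝕜 E) : 0 < upperRatio P Q := by
  obtain ⟨x, hx⟩ := exists_pos_quadForm hP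
  exact pos_of_mul_pos_left (hx.trans_le (quadForm_le_upperRatio_mul hP hQ x))
    (hQ.1.quadForm_nonneg x)

lemma exp_thompsonDist [Nontrivial E] {P Q : E →L[𝕜] E} (hP : P ∈ posInvOps 𝕜 E)
    (hQ : Q ∈ posInvOps 𝕜 E) :
    Real.exp (thompsonDist P Q) = max (upperRatio P Q) (upperRatio Q P) :=
  Real.exp_log (lt_max_of_lt_left (upperRatio_pos hP hQ))

lemma quadForm_le_exp_thompsonDist_mul [Nontrivial E] {P Q : E →L[𝕜] E}
    (hP : P ∈ posInvOps 𝕜 E) (hQ : Q ∈ posInvOps 𝕜 E) (x : E) :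
    quadForm P x ≤ Real.exp (thompsonDist P Q) * quadForm Q x := by
  rw [exp_thompsonDist hP hQ]
  exact (quadForm_le_upperRatio_mul hP hQ x).trans
    (mul_le_mul_of_nonneg_right (le_max_left _ _) (hQ.1.quadForm_nonneg x))

lemma thompsonDist_comm {X : Type*} [LE X] [SMul ℝ X] (P Q : X) :
    thompsonDist P Q = thompsonDist Q P := by
  rw [thompsonDist, thompsonDist, max_comm]

lemma thompsonDist_le [Nontrivial E] {P Q : E →L[𝕜] E} (hP : P ∈ posInvOps 𝕜 E)
    (hQ : Q ∈ posInvOps 𝕜 E) {r : ℝ} (h1 : ∀ x, quadForm P x ≤ Real.exp r * quadForm Q x)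
    (h2 : ∀ x, quadForm Q x ≤ Real.exp r * quadForm P x) : thompsonDist P Q ≤ r := by
  rw [← Real.exp_le_exp, exp_thompsonDist hP hQ]
  exact max_le (upperRatio_le hP hQ h1) (upperRatio_le hQ hP h2)

lemma thompsonDist_nonneg [Nontrivial E] {P Q : E →L[𝕜] E} (hP : P ∈ posInvOps 𝕜 E)
    (hQ : Q ∈ posInvOps 𝕜 E) : 0 ≤ thompsonDist P Q := by
  obtain ⟨x, hx⟩ := exists_pos_quadForm hP
  have h1 := quadForm_le_exp_thompsonDist_mul hP hQ x
  have h2 := quadForm_le_exp_thompsonDist_mul hQ hP x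
  rw [thompsonDist_comm] at h2
  by_contra! hneg
  have h3 : Real.exp (thompsonDist P Q) < 1 := by
    simpa using Real.exp_lt_exp.2 hneg
  have h4 := Real.exp_pos (thompsonDist P Q)
  have h5 := mul_le_mul_of_nonneg_left h2 h4.le
  have h6 := mul_pos (mul_pos (sub_pos.2 h3) (by linarith : 0 < 1 + Real.exp (thompsonDist P Q))) hx
  linarith

lemma thompsonDist_smul_le [Nontrivial E] {P : E →L[𝕜] E} (hP : P ∈ posInvOps 𝕜 E) {c : ℝ}
    (hc : 1 ≤ c) : thompsonDist (c • P) P ≤ Real.log c := by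
  have hc0 : 0 < c := by linarith
  refine thompsonDist_le (smul_mem_posInvOps hP hc0) hP (fun x => ?_) fun x => ?_
  · rw [Real.exp_log hc0, quadForm_smul]
  · rw [Real.exp_log hc0, quadForm_smul]
    have := hP.1.quadForm_nonneg x
    nlinarith [mul_nonneg (mul_nonneg (sub_nonneg.2 hc) this) (by linarith : 0 ≤ c + 1)]

end ThompsonMetric

/-! ### Solutions and exit times -/

section Solutions

variable {X : Type*} [NormedAddCommGroup X] [NormedSpace ℝ X]

lemma isSolution_mono {φ : ℝ → X → X} {U : Set X} {s b b' : ℝ}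
    {P : ℝ → X} (h : IsSolution φ U s b P) (hb : b' ≤ b) : IsSolution φ U s b' P :=
  fun t ht => ⟨(h t ⟨ht.1, ht.2.trans_le hb⟩).1,
    (h t ⟨ht.1, ht.2.trans_le hb⟩).2.mono (Ico_subset_Ico_right hb)⟩

theorem exists_solution_of_lt_exitTime {φ : ℝ → X → X}
    {𝒟 U : Set X} {s t : ℝ} {P₀ : X} (h : (t : EReal) < exitTime φ 𝒟 U s P₀) :
    ∃ b, t < b ∧ ∃ P : ℝ → X, IsSolution φ 𝒟 s b P ∧ P s = P₀ ∧
      ∀ τ ∈ Ico s b, P τ ∈ U := by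
  obtain ⟨_, ⟨b, rfl, -, P, hP⟩, htb⟩ := lt_sSup_iff.1 h
  exact ⟨b, EReal.coe_lt_coe_iff.1 htb, P, hP⟩

theorem lt_exitTime {φ : ℝ → X → X}
    {𝒟 U : Set X} {s t b : ℝ} {P : ℝ → X} (ht : t ∈ Ico s b)
    (hP : IsSolution φ 𝒟 s b P) (hU : ∀ τ ∈ Ico s b, P τ ∈ U) :
    (t : EReal) < exitTime φ 𝒟 U s (P s) :=
  lt_sSup_iff.2 ⟨b, ⟨b, rfl, ht.1.trans_lt ht.2, P, hP, rfl, hU⟩, EReal.coe_lt_coe_iff.2 ht.2⟩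

end Solutions

section Comparison

variable {𝕜 E : Type*} [RCLike 𝕜] [NormedAddCommGroup E] [InnerProductSpace 𝕜 E] [CompleteSpace E]
  [NormedSpace ℝ E] [IsScalarTower ℝ 𝕜 E]

/-! ### Comparison for the Riccati equation -/

/-- If `V' ≥ B' V + V B + δ I` at `t` and `V t` is nonnegative, then `V` is nonnegative on a right
neighbourhood of `t`. -/
lemma eventually_quadForm_nonneg {V : ℝ → E →L[𝕜] E} {V' B : E →L[𝕜] E} {t δ : ℝ} (hδ : 0 < δ)
    (hV : HasDerivWithinAt V V' (Ioi t) t) (h0 : ∀ x, 0 ≤ quadForm (V t) x)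
    (hV' : ∀ x, δ * ‖x‖ ^ 2 ≤ quadForm (V' - (adjoint B * V t + V t * B)) x) :
    ∀ᶠ τ in 𝓝[>] t, ∀ x, 0 ≤ quadForm (V τ) x := by
  set G : E →L[𝕜] E := V' - (adjoint B * V t + V t * B) with hG
  -- The subtracted congruence of `V t` is nonnegative and absorbs the linear terms `B' V + V B`.
  -- The remainder `N` vanishes at `t` with derivative `G ≥ δ I`, and its first-order error is small
  -- in operator norm, hence uniformly in `x`.
  set N : ℝ → E →L[𝕜] E := fun τ =>
    V τ - adjoint (1 + (τ - t) • B) * V t * (1 + (τ - t) • B) with hN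
  have hadj : ∀ τ : ℝ, adjoint (1 + (τ - t) • B) = 1 + (τ - t) • adjoint B := by
    intro τ
    rw [← star_eq_adjoint, ← star_eq_adjoint, star_add, star_one, star_smul, star_trivial]
  have hl : HasDerivWithinAt (fun τ : ℝ => τ - t) 1 (Ioi t) t :=
    (hasDerivWithinAt_id t _).sub_const t
  have hNt : N t = 0 := by simp [hN, hadj]
  have hd : HasDerivWithinAt N G (Ioi t) t := by
    have h1 : HasDerivWithinAt (fun τ : ℝ => 1 + (τ - t) • B) B (Ioi t) t := by
      simpa using (hl.smul_const B).const_add (1 : E →L[𝕜] E)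
    have h2 : HasDerivWithinAt (fun τ : ℝ => 1 + (τ - t) • adjoint B) (adjoint B) (Ioi t) t := by
      simpa using (hl.smul_const (adjoint B)).const_add (1 : E →L[𝕜] E)
    have h3 := hV.sub ((h2.mul_const (V t)).mul h1)
    have hNe : N = fun τ => V τ - (1 + (τ - t) • adjoint B) * V t * (1 + (τ - t) • B) :=
      funext fun τ => by rw [← hadj]
    rw [hNe]
    refine HasDerivWithinAt.congr_deriv (f' := _) h3 ?_
    simp [hG]
  have hlo := hasDerivWithinAt_iff_isLittleO.1 hd
  have hb := hlo.bound hδ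
  filter_upwards [hb, self_mem_nhdsWithin] with τ hτ hτt x
  have hpos : 0 < τ - t := sub_pos.2 hτt
  rw [hNt, sub_zero, Real.norm_of_nonneg hpos.le] at hτ
  have e : V τ = N τ + adjoint (1 + (τ - t) • B) * V t * (1 + (τ - t) • B) := by simp [hN]
  rw [e, quadForm_add, quadForm_conj]
  have h1 := neg_le_quadForm (N τ - (τ - t) • G) x
  rw [quadForm_sub, quadForm_smul] at h1
  have h2 : ‖N τ - (τ - t) • G‖ * ‖x‖ ^ 2 ≤ δ * (τ - t) * ‖x‖ ^ 2 := by gcongr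
  have h3 := mul_le_mul_of_nonneg_left (hV' x) hpos.le
  have h4 := h0 ((1 + (τ - t) • B) x)
  linarith

lemma hasDerivWithinAt_Ioi_of_Ico {F : Type*} [NormedAddCommGroup F] [NormedSpace ℝ F]
    {f : ℝ → F} {f' : F} {s b t : ℝ} (ht : t ∈ Ico s b) (h : HasDerivWithinAt f f' (Ico s b) t) :
    HasDerivWithinAt f f' (Ioi t) t := by
  refine h.mono_of_mem_nhdsWithin ?_
  exact mem_of_superset (Ioo_mem_nhdsGT ht.2) fun τ hτ => ⟨ht.1.trans hτ.1.le, hτ.2⟩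

/-- Nonnegativity is preserved by the differential inequality `W' ≥ B' W + W B`. -/
theorem quadForm_nonneg_of_deriv {W W' B : ℝ → E →L[𝕜] E} {s b : ℝ}
    (hW : ∀ t ∈ Ico s b, HasDerivWithinAt W (W' t) (Ico s b) t) (hB : ContinuousOn B (Ico s b))
    (h : ∀ t ∈ Ico s b, ∀ x,
      quadForm (adjoint (B t) * W t + W t * B t) x ≤ quadForm (W' t) x)
    (h0 : ∀ x, 0 ≤ quadForm (W s) x) {t : ℝ} (ht : t ∈ Ico s b) (x : E) :
    0 ≤ quadForm (W t) x := by
  have hsub : Icc s t ⊆ Ico s b := fun τ hτ => ⟨hτ.1, hτ.2.trans_lt ht.2⟩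
  obtain ⟨C, hC⟩ := isCompact_Icc.exists_bound_of_continuousOn (hB.mono hsub)
  have hC0 : 0 ≤ C := (norm_nonneg _).trans (hC s ⟨le_rfl, ht.1⟩)
  -- `2C` bounds `‖B' + B‖`; the extra `1` leaves the perturbation `ε e^{K(τ-s)} I` a strict slack
  -- of exactly `ε e^{K(τ-s)}`.
  set K : ℝ := 2 * C + 1 with hK
  have key : ∀ ε > 0, 0 ≤ quadForm (W t) x + ε * Real.exp (K * (t - s)) * ‖x‖ ^ 2 := by
    intro ε hε
    set V : ℝ → E →L[𝕜] E := fun τ => W τ + (ε * Real.exp (K * (τ - s))) • (1 : E →L[𝕜] E)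
      with hV
    have hVc : ContinuousOn V (Icc s t) := by
      refine ContinuousOn.add (fun τ hτ => ((hW τ (hsub hτ)).continuousWithinAt).mono hsub) ?_
      fun_prop
    have hcl : IsClosed ({τ | ∀ y, 0 ≤ quadForm (V τ) y} ∩ Icc s t) := by
      have : {τ | ∀ y, 0 ≤ quadForm (V τ) y} ∩ Icc s t =
          Icc s t ∩ V ⁻¹' {T | ∀ y, 0 ≤ quadForm T y} := by ext; simp [and_comm]
      rw [this]
      refine hVc.preimage_isClosed_of_isClosed isClosed_Icc ?_
      have : {T : E →L[𝕜] E | ∀ y, 0 ≤ quadForm T y} =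
          ⋂ y, {T : E →L[𝕜] E | 0 ≤ quadForm T y} := by ext; simp
      rw [this]
      exact isClosed_iInter fun y =>
        isClosed_le continuous_const (quadFormCLM 𝕜 y).continuous
    have hs0 : s ∈ {τ | ∀ y, 0 ≤ quadForm (V τ) y} := by
      intro y
      simp only [hV, quadForm_add, quadForm_smul, quadForm_one]
      have := h0 y
      positivity
    have hall := hcl.Icc_subset_of_forall_mem_nhdsWithin hs0 fun τ hτ => by
      have hτ' : τ ∈ Ico s b := hsub ⟨hτ.2.1, hτ.2.2.le⟩
      have hexp : HasDerivAt (fun τ => ε * Real.exp (K * (τ - s)))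
          (ε * (Real.exp (K * (τ - s)) * K)) τ := by
        have : HasDerivAt (fun τ : ℝ => K * (τ - s)) K τ := by
          simpa using ((hasDerivAt_id τ).sub_const s).const_mul K
        exact this.exp.const_mul ε
      have hVd : HasDerivWithinAt V
          (W' τ + (ε * (Real.exp (K * (τ - s)) * K)) • (1 : E →L[𝕜] E)) (Ioi τ) τ :=
        (hasDerivWithinAt_Ioi_of_Ico hτ' (hW τ hτ')).add
          (hexp.hasDerivWithinAt.smul_const (1 : E →L[𝕜] E))
      refine eventually_quadForm_nonneg (B := B τ) (δ := ε * Real.exp (K * (τ - s)))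
        (by positivity) hVd hτ.1 fun y => ?_
      have hBn : ‖B τ‖ ≤ C := hC τ ⟨hτ.2.1, hτ.2.2.le⟩
      have hnorm : ‖adjoint (B τ) + B τ‖ ≤ 2 * C := by
        refine (norm_add_le _ _).trans ?_
        rw [LinearIsometryEquiv.norm_map]; linarith
      have hy := quadForm_le (adjoint (B τ) + B τ) y
      have hy2 : ‖adjoint (B τ) + B τ‖ * ‖y‖ ^ 2 ≤ 2 * C * ‖y‖ ^ 2 := by gcongr
      have hyW := h τ hτ' y
      have e : adjoint (B τ) * V τ + V τ * B τ = (adjoint (B τ) * W τ + W τ * B τ) +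
          (ε * Real.exp (K * (τ - s))) • (adjoint (B τ) + B τ) := by
        simp only [hV, mul_add, add_mul, mul_smul_comm, smul_mul_assoc, mul_one, one_mul, smul_add]
        abel
      rw [e]
      simp only [quadForm_sub, quadForm_add, quadForm_smul, quadForm_one] at hy hyW ⊢
      have he : 0 < ε * Real.exp (K * (τ - s)) := by positivity
      nlinarith
    have := hall (right_mem_Icc.2 ht.1) x
    simpa [hV] using this
  have hlim : Tendsto (fun ε : ℝ => quadForm (W t) x + ε * Real.exp (K * (t - s)) * ‖x‖ ^ 2)
      (𝓝[>] 0) (𝓝 (quadForm (W t) x + 0 * Real.exp (K * (t - s)) * ‖x‖ ^ 2)) := by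
    refine Tendsto.mono_left ?_ nhdsWithin_le_nhds
    exact Continuous.tendsto (by fun_prop) 0
  rw [zero_mul, zero_mul, add_zero] at hlim
  exact ge_of_tendsto hlim (eventually_mem_nhdsWithin.mono fun ε hε => key ε hε)

variable {A D S : ℝ → E →L[𝕜] E}

/-- A solution of the Riccati equation stays below every supersolution. -/
theorem quadForm_le_of_supersolution (hA : Continuous A) (hS : Continuous S)
    (hS_sym : ∀ t, S t ∈ symOps 𝕜 E) {P Q Q' : ℝ → E →L[𝕜] E} {s b : ℝ}
    (hP : IsSolution (riccatiField A D S) (symOps 𝕜 E) s b P)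
    (hQ_sym : ∀ t ∈ Ico s b, IsSelfAdjoint (Q t))
    (hQ : ∀ t ∈ Ico s b, HasDerivWithinAt Q (Q' t) (Ico s b) t)
    (hQ' : ∀ t ∈ Ico s b, ∀ x, quadForm (riccatiField A D S t (Q t)) x ≤ quadForm (Q' t) x)
    (h0 : ∀ x, quadForm (P s) x ≤ quadForm (Q s) x) {t : ℝ} (ht : t ∈ Ico s b) (x : E) :
    quadForm (P t) x ≤ quadForm (Q t) x := by
  have hPc : ContinuousOn P (Ico s b) := fun τ hτ => (hP τ hτ).2.continuousWithinAt
  have hQc : ContinuousOn Q (Ico s b) := fun τ hτ => (hQ τ hτ).continuousWithinAt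
  -- Symmetrising `QΣQ - PΣP` around the mean `(Q + P)/2` turns the difference of the two Riccati
  -- fields into a linear expression `B' W + W B` in `W = Q - P`.
  have h := quadForm_nonneg_of_deriv (W := fun τ => Q τ - P τ)
    (W' := fun τ => Q' τ - riccatiField A D S τ (P τ))
    (B := fun τ => A τ - S τ * ((1 / 2 : ℝ) • (Q τ + P τ)))
    (fun τ hτ => (hQ τ hτ).sub (hP τ hτ).2)
    (hA.continuousOn.sub (hS.continuousOn.mul (ContinuousOn.const_smul (hQc.add hPc) (1 / 2 : ℝ))))
    (fun τ hτ y => ?_) (fun y => by simpa using h0 y) ht x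
  · simpa using h
  · have hK : adjoint (A τ - S τ * ((1 / 2 : ℝ) • (Q τ + P τ))) =
        adjoint (A τ) - ((1 / 2 : ℝ) • (Q τ + P τ)) * S τ := by
      rw [← star_eq_adjoint, ← star_eq_adjoint, star_sub, star_mul, star_smul, star_add,
        (hQ_sym τ hτ).star_eq, (show IsSelfAdjoint (P τ) from (hP τ hτ).1).star_eq,
        (show IsSelfAdjoint (S τ) from hS_sym τ).star_eq, star_trivial (1 / 2 : ℝ)]
    have e : (adjoint (A τ) - ((1 / 2 : ℝ) • (Q τ + P τ)) * S τ) * (Q τ - P τ) +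
        (Q τ - P τ) * (A τ - S τ * ((1 / 2 : ℝ) • (Q τ + P τ))) =
        riccatiField A D S τ (Q τ) - riccatiField A D S τ (P τ) := by
      have e1 : (adjoint (A τ) - ((1 / 2 : ℝ) • (Q τ + P τ)) * S τ) * (Q τ - P τ) +
        (Q τ - P τ) * (A τ - S τ * ((1 / 2 : ℝ) • (Q τ + P τ))) =
        (adjoint (A τ) * (Q τ - P τ) + (Q τ - P τ) * A τ) -
        (1 / 2 : ℝ) • ((Q τ + P τ) * S τ * (Q τ - P τ) + (Q τ - P τ) * S τ * (Q τ + P τ)) := by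
        simp only [sub_mul, mul_sub, add_mul, mul_add, mul_smul_comm, smul_mul_assoc, smul_add, smul_sub, mul_assoc]
        abel
      have e2 : (Q τ + P τ) * S τ * (Q τ - P τ) + (Q τ - P τ) * S τ * (Q τ + P τ) =
          (2 : ℝ) • (Q τ * S τ * Q τ - P τ * S τ * P τ) := by
        rw [two_smul]; noncomm_ring
      rw [e1, e2, smul_smul]
      norm_num [riccatiField]
      noncomm_ring
    rw [hK, e, quadForm_sub, quadForm_sub]
    have := hQ' τ hτ y
    linarith

/-- Uniqueness for the initial value problem of the Riccati equation. -/
theorem isSolution_unique (hA : Continuous A) (hS : Continuous S)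
    (hS_sym : ∀ t, S t ∈ symOps 𝕜 E) {P Q : ℝ → E →L[𝕜] E} {s b : ℝ}
    (hP : IsSolution (riccatiField A D S) (symOps 𝕜 E) s b P)
    (hQ : IsSolution (riccatiField A D S) (symOps 𝕜 E) s b Q) (h0 : P s = Q s)
    {t : ℝ} (ht : t ∈ Ico s b) : P t = Q t := by
  -- Each solution is a supersolution for the other.
  refine le_antisymm ?_ ?_
  · rw [le_iff_quadForm (hP t ht).1 (hQ t ht).1]
    exact quadForm_le_of_supersolution hA hS hS_sym hP (fun τ hτ => (hQ τ hτ).1)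
      (fun τ hτ => (hQ τ hτ).2) (fun τ hτ x => le_rfl) (fun x => by rw [h0]) ht
  · rw [le_iff_quadForm (hQ t ht).1 (hP t ht).1]
    exact quadForm_le_of_supersolution hA hS hS_sym hQ (fun τ hτ => (hP τ hτ).1)
      (fun τ hτ => (hP τ hτ).2) (fun τ hτ x => le_rfl) (fun x => by rw [h0]) ht

/-- `flow` selects some solution by choice; uniqueness on the common interval makes its value that
of any given solution. -/
theorem flow_eq (hA : Continuous A) (hS : Continuous S) (hS_sym : ∀ t, S t ∈ symOps 𝕜 E)
    {P : ℝ → E →L[𝕜] E} {s b : ℝ}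
    (hP : IsSolution (riccatiField A D S) (symOps 𝕜 E) s b P) {t : ℝ} (ht : t ∈ Ico s b) :
    flow (riccatiField A D S) (symOps 𝕜 E) s t (P s) = P t := by
  have h : ∃ x : ℝ → E →L[𝕜] E, (∃ c : ℝ, t < c ∧
      IsSolution (riccatiField A D S) (symOps 𝕜 E) s c x) ∧ x s = P s := ⟨P, ⟨b, ht.2, hP⟩, rfl⟩
  rw [flow, dif_pos h]
  obtain ⟨⟨c, htc, hc⟩, hs⟩ := h.choose_spec
  exact isSolution_unique hA hS hS_sym (isSolution_mono hc (min_le_left c b))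
    (isSolution_mono hP (min_le_right c b)) hs ⟨ht.1, lt_min htc ht.2⟩

end Comparison

section Existence

/-! ### Local existence -/

open scoped NNReal in
/-- Local existence to the right for a time-dependent vector field that is locally Lipschitz and
continuous. -/
theorem exists_rightSolution {X : Type*} [NormedAddCommGroup X] [NormedSpace ℝ X]
    [CompleteSpace X] {f : ℝ → X → X} {s : ℝ} {x₀ : X} {L K : ℝ≥0}
    (hlip : ∀ t ∈ Icc s (s + 1), LipschitzOnWith K (f t) (Metric.closedBall x₀ 1))
    (hcont : ∀ x, Continuous fun t => f t x)
    (hbd : ∀ t ∈ Icc s (s + 1), ∀ x ∈ Metric.closedBall x₀ 1, ‖f t x‖ ≤ L) :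
    ∃ b, s < b ∧ ∃ x : ℝ → X, x s = x₀ ∧
      ∀ t ∈ Ico s b, HasDerivWithinAt x (f t (x t)) (Ico s b) t := by
  -- With speed at most `L`, a time `h` with `L * h ≤ 1` keeps the solution in the unit ball around
  -- `x₀`; also `h ≤ 1`, where the bounds hold.
  set h : ℝ := 1 / ((L : ℝ) + 1) with hh
  have hL : (0 : ℝ) < (L : ℝ) + 1 := by positivity
  have hh0 : 0 < h := by positivity
  have hh1 : h ≤ 1 := by
    rw [hh, div_le_one hL]; linarith [L.coe_nonneg]
  have hsub : Icc s (s + h) ⊆ Icc s (s + 1) := Icc_subset_Icc_right (by linarith)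
  have hpl : IsPicardLindelof f (tmin := s) (tmax := s + h) ⟨s, ⟨le_rfl, by linarith⟩⟩ x₀ 1 0 L K :=
    { lipschitzOnWith := fun t ht => by simpa using hlip t (hsub ht)
      continuousOn := fun x _ => (hcont x).continuousOn
      norm_le := fun t ht x hx => hbd t (hsub ht) x (by simpa using hx)
      mul_max_le := by
        have : max (s + h - s) (s - s) = h := by
          rw [add_sub_cancel_left, sub_self, max_eq_left hh0.le]
        simp only [this, NNReal.coe_one, NNReal.coe_zero, sub_zero]
        rw [hh, mul_one_div, div_le_one hL]
        linarith }
  obtain ⟨x, hx0, hx⟩ := hpl.exists_eq_forall_mem_Icc_hasDerivWithinAt₀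
  exact ⟨s + h, by linarith, x, hx0, fun t ht =>
    (hx t (Ico_subset_Icc_self ht)).mono Ico_subset_Icc_self⟩

variable {𝕜 E : Type*} [RCLike 𝕜] [NormedAddCommGroup E] [InnerProductSpace 𝕜 E] [CompleteSpace E]
  {A D S : ℝ → E →L[𝕜] E}

lemma isSelfAdjoint_riccatiField (hD : ∀ t, D t ∈ symOps 𝕜 E) (hS : ∀ t, S t ∈ symOps 𝕜 E)
    {P : E →L[𝕜] E} (hP : IsSelfAdjoint P) (t : ℝ) :
    IsSelfAdjoint (riccatiField A D S t P) := by
  have h1 : star (D t) = D t := hD t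
  have h2 : star (S t) = S t := hS t
  have h3 : star P = P := hP
  rw [isSelfAdjoint_iff, riccatiField, ← star_eq_adjoint]
  simp only [star_sub, star_add, star_mul, star_star, h1, h2, h3]
  noncomm_ring

lemma continuous_riccatiField (hA : Continuous A) (hD : Continuous D) (hS : Continuous S)
    (P : E →L[𝕜] E) : Continuous fun t => riccatiField A D S t P := by
  have hA' : Continuous fun t => adjoint (A t) := adjoint.continuous.comp hA
  unfold riccatiField
  fun_prop

lemma norm_riccatiField_le {C : ℝ} {t : ℝ} (hA : ‖A t‖ ≤ C) (hD : ‖D t‖ ≤ C) (hS : ‖S t‖ ≤ C)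
    {P : E →L[𝕜] E} {r : ℝ} (hP : ‖P‖ ≤ r) :
    ‖riccatiField A D S t P‖ ≤ C * r + r * C + C + r * C * r := by
  have hC : 0 ≤ C := (norm_nonneg _).trans hA
  have hr : 0 ≤ r := (norm_nonneg _).trans hP
  have hA' : ‖adjoint (A t)‖ ≤ C := by rwa [LinearIsometryEquiv.norm_map]
  refine (norm_sub_le _ _).trans (add_le_add ((norm_add_le _ _).trans (add_le_add
    ((norm_add_le _ _).trans (add_le_add ?_ ?_)) hD)) ?_)
  · exact (norm_mul_le _ _).trans (by gcongr)
  · exact (norm_mul_le _ _).trans (by gcongr)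
  · exact (norm_mul_le _ _).trans (by gcongr; exact (norm_mul_le _ _).trans (by gcongr))

lemma norm_riccatiField_sub_le {C : ℝ} {t : ℝ} (hA : ‖A t‖ ≤ C) (hS : ‖S t‖ ≤ C)
    {P Q : E →L[𝕜] E} {r : ℝ} (hP : ‖P‖ ≤ r) (hQ : ‖Q‖ ≤ r) :
    ‖riccatiField A D S t P - riccatiField A D S t Q‖ ≤ (2 * C + 2 * (r * C)) * ‖P - Q‖ := by
  have hC : 0 ≤ C := (norm_nonneg _).trans hA
  have hr : 0 ≤ r := (norm_nonneg _).trans hP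
  have hA' : ‖adjoint (A t)‖ ≤ C := by rwa [LinearIsometryEquiv.norm_map]
  have e : riccatiField A D S t P - riccatiField A D S t Q =
      adjoint (A t) * (P - Q) + (P - Q) * A t - (P * S t * (P - Q) + (P - Q) * S t * Q) := by
    unfold riccatiField; noncomm_ring
  rw [e]
  have h1 : ‖adjoint (A t) * (P - Q)‖ ≤ C * ‖P - Q‖ := (norm_mul_le _ _).trans (by gcongr)
  have h2 : ‖(P - Q) * A t‖ ≤ ‖P - Q‖ * C := (norm_mul_le _ _).trans (by gcongr)
  have h3 : ‖P * S t * (P - Q)‖ ≤ r * C * ‖P - Q‖ :=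
    (norm_mul_le _ _).trans (by gcongr; exact (norm_mul_le _ _).trans (by gcongr))
  have h4 : ‖(P - Q) * S t * Q‖ ≤ ‖P - Q‖ * C * r :=
    (norm_mul_le _ _).trans (by gcongr; exact (norm_mul_le _ _).trans (by gcongr))
  have h5 := norm_sub_le (adjoint (A t) * (P - Q) + (P - Q) * A t)
    (P * S t * (P - Q) + (P - Q) * S t * Q)
  have h6 := norm_add_le (adjoint (A t) * (P - Q)) ((P - Q) * A t)
  have h7 := norm_add_le (P * S t * (P - Q)) ((P - Q) * S t * Q)
  nlinarith

variable [NormedSpace ℝ E] [IsScalarTower ℝ 𝕜 E]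

/-- The self-adjoint part of an operator. -/
def symPart (T : E →L[𝕜] E) : E →L[𝕜] E := (1 / 2 : ℝ) • (T + star T)

lemma symPart_of_isSelfAdjoint {T : E →L[𝕜] E} (hT : IsSelfAdjoint T) : symPart T = T := by
  rw [symPart, hT.star_eq, ← two_smul ℝ T, smul_smul]; norm_num

lemma isSelfAdjoint_symPart (T : E →L[𝕜] E) : IsSelfAdjoint (symPart T) :=
  isSelfAdjoint_smul (by rw [isSelfAdjoint_iff, star_add, star_star, add_comm]) _

lemma symPart_sub (S T : E →L[𝕜] E) : symPart S - symPart T = symPart (S - T) := by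
  rw [symPart, symPart, symPart, ← smul_sub, star_sub]; congr 1; abel

lemma norm_symPart_le (T : E →L[𝕜] E) : ‖symPart T‖ ≤ ‖T‖ := by
  rw [symPart, norm_smul]
  have := norm_add_le T (star T)
  rw [star_eq_adjoint, LinearIsometryEquiv.norm_map] at this
  rw [star_eq_adjoint]
  norm_num
  linarith

/-- The Riccati equation with self-adjoint initial value has a self-adjoint local solution. -/
theorem exists_isSolution (hA : Continuous A) (hD : Continuous D) (hS : Continuous S)
    (hA_bdd : ∃ C : ℝ, ∀ t, ‖A t‖ ≤ C) (hD_bdd : ∃ C : ℝ, ∀ t, ‖D t‖ ≤ C)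
    (hS_bdd : ∃ C : ℝ, ∀ t, ‖S t‖ ≤ C) (hD_sym : ∀ t, D t ∈ symOps 𝕜 E)
    (hS_sym : ∀ t, S t ∈ symOps 𝕜 E) (s : ℝ) {P₀ : E →L[𝕜] E} (hP₀ : IsSelfAdjoint P₀) :
    ∃ b, s < b ∧ ∃ P : ℝ → E →L[𝕜] E, P s = P₀ ∧
      IsSolution (riccatiField A D S) (symOps 𝕜 E) s b P := by
  obtain ⟨CA, hCA⟩ := hA_bdd
  obtain ⟨CD, hCD⟩ := hD_bdd
  obtain ⟨CS, hCS⟩ := hS_bdd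
  set C : ℝ := max CA (max CD CS) with hC_def
  have hA' : ∀ t, ‖A t‖ ≤ C := fun t => (hCA t).trans (le_max_left _ _)
  have hD' : ∀ t, ‖D t‖ ≤ C := fun t => (hCD t).trans ((le_max_left _ _).trans (le_max_right _ _))
  have hS' : ∀ t, ‖S t‖ ≤ C := fun t => (hCS t).trans ((le_max_right _ _).trans (le_max_right _ _))
  have hC : 0 ≤ C := (norm_nonneg _).trans (hA' 0)
  set r : ℝ := ‖P₀‖ + 1 with hr_def
  have hr : 0 ≤ r := by positivity
  have hball : ∀ T ∈ Metric.closedBall P₀ 1, ‖symPart T‖ ≤ r := by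
    intro T hT
    rw [mem_closedBall_iff_norm] at hT
    have := norm_add_le P₀ (T - P₀)
    rw [add_sub_cancel] at this
    exact (norm_symPart_le T).trans (by linarith)
  -- The field is evaluated at the self-adjoint part, so the derivative is self-adjoint at every
  -- point of the full operator space. Then `P - P*` is constant, hence zero, and the original
  -- equation is recovered.
  obtain ⟨b, hb, P, hP0, hP⟩ := exists_rightSolution (x₀ := P₀) (s := s)
    (f := fun t T => riccatiField A D S t (symPart T))
    (L := ⟨C * r + r * C + C + r * C * r, by positivity⟩)
    (K := ⟨2 * C + 2 * (r * C), by positivity⟩)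
    (fun t _ => LipschitzOnWith.of_dist_le_mul fun T hT T' hT' => by
      rw [dist_eq_norm, dist_eq_norm]
      refine (norm_riccatiField_sub_le (hA' t) (hS' t) (hball T hT) (hball T' hT')).trans ?_
      rw [symPart_sub]
      exact mul_le_mul_of_nonneg_left (norm_symPart_le _) (by positivity))
    (fun T => continuous_riccatiField hA hD hS _)
    (fun t _ T hT => norm_riccatiField_le (hA' t) (hD' t) (hS' t) (hball T hT))
  have hsym : ∀ t ∈ Ico s b, IsSelfAdjoint (P t) := by
    intro t ht
    have hsub : Icc s t ⊆ Ico s b := fun τ hτ => ⟨hτ.1, hτ.2.trans_lt ht.2⟩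
    have hd : ∀ τ ∈ Ico s b, HasDerivWithinAt (fun τ => P τ - star (P τ)) 0 (Ico s b) τ := by
      intro τ hτ
      have h := (hP τ hτ).sub (hP τ hτ).star
      rwa [(isSelfAdjoint_riccatiField hD_sym hS_sym (isSelfAdjoint_symPart _) τ).star_eq,
        sub_self] at h
    have h := constant_of_has_deriv_right_zero (f := fun τ => P τ - star (P τ)) (a := s) (b := t)
      (fun τ hτ => (hd τ (hsub hτ)).continuousWithinAt.mono hsub)
      (fun τ hτ => (hasDerivWithinAt_Ioi_of_Ico (hsub ⟨hτ.1, hτ.2.le⟩)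
        (hd τ (hsub ⟨hτ.1, hτ.2.le⟩))).Ici_of_Ioi) t ⟨ht.1, le_rfl⟩
    simp only [hP0, hP₀.star_eq, sub_self, sub_eq_zero] at h
    exact h.symm
  refine ⟨b, hb, P, hP0, fun t ht => ⟨hsym t ht, ?_⟩⟩
  have := hP t ht
  rwa [symPart_of_isSelfAdjoint (hsym t ht)] at this

/-- A solution starting in the set of positive semidefinite invertible operators stays there for
some time. -/
theorem exists_isSolution_posInvOps (hA : Continuous A) (hD : Continuous D) (hS : Continuous S)
    (hA_bdd : ∃ C : ℝ, ∀ t, ‖A t‖ ≤ C) (hD_bdd : ∃ C : ℝ, ∀ t, ‖D t‖ ≤ C)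
    (hS_bdd : ∃ C : ℝ, ∀ t, ‖S t‖ ≤ C) (hD_sym : ∀ t, D t ∈ symOps 𝕜 E)
    (hS_sym : ∀ t, S t ∈ symOps 𝕜 E) (s : ℝ) {P₀ : E →L[𝕜] E} (hP₀ : P₀ ∈ posInvOps 𝕜 E) :
    ∃ b, s < b ∧ ∃ P : ℝ → E →L[𝕜] E, P s = P₀ ∧
      IsSolution (riccatiField A D S) (symOps 𝕜 E) s b P ∧ ∀ t ∈ Ico s b, P t ∈ posInvOps 𝕜 E := by
  obtain ⟨hsym, c, hc, hcP⟩ := mem_posInvOps_iff.1 hP₀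
  obtain ⟨b, hb, P, hP0, hP⟩ :=
    exists_isSolution hA hD hS hA_bdd hD_bdd hS_bdd hD_sym hS_sym s hsym
  have hcont : ContinuousWithinAt P (Ico s b) s := (hP s ⟨le_rfl, hb⟩).2.continuousWithinAt
  obtain ⟨δ, hδ, hball⟩ := Metric.continuousWithinAt_iff.1 hcont (c / 2) (by positivity)
  refine ⟨min b (s + δ), lt_min hb (by linarith), P, hP0,
    isSolution_mono hP (min_le_left _ _), fun t ht => ?_⟩
  have htb : t ∈ Ico s b := ⟨ht.1, ht.2.trans_le (min_le_left _ _)⟩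
  have hts : t < s + δ := ht.2.trans_le (min_le_right _ _)
  have hd : ‖P t - P₀‖ < c / 2 := by
    rw [← hP0, ← dist_eq_norm]
    refine hball htb ?_
    rw [Real.dist_eq, abs_of_nonneg (sub_nonneg.2 ht.1)]
    linarith
  refine mem_posInvOps_iff.2 ⟨(hP t htb).1, c / 2, by positivity, fun x => ?_⟩
  have h1 := neg_le_quadForm (P t - P₀) x
  have h2 := hcP x
  have h3 : ‖P t - P₀‖ * ‖x‖ ^ 2 ≤ c / 2 * ‖x‖ ^ 2 := by gcongr
  rw [quadForm_sub] at h1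
  linarith

end Existence

section ContractionRate

/-! ### The contraction rates -/

lemma deriv_nonneg_of_nonneg {g : ℝ → ℝ} {g' s b : ℝ} (hsb : s < b)
    (hg : HasDerivWithinAt g g' (Ico s b) s) (h0 : g s = 0) (h : ∀ t ∈ Ico s b, 0 ≤ g t) :
    0 ≤ g' := by
  have hd := hasDerivWithinAt_Ioi_of_Ico ⟨le_rfl, hsb⟩ hg
  have ht := (hasDerivWithinAt_iff_tendsto_slope' (by simp)).1 hd
  refine ge_of_tendsto ht ?_
  filter_upwards [Ioo_mem_nhdsGT hsb] with t ht
  rw [slope_def_field, h0, sub_zero]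
  exact div_nonneg (h t ⟨ht.1.le, ht.2⟩) (sub_nonneg.2 ht.1.le)

/-- Dividing the hypothesis by `τ²` gives `βp/τ ≤ b + a/τ²`; integrate over `[1, c]` and multiply by
`c`. -/
lemma mul_log_le_of_forall {a b p β : ℝ} (h : ∀ τ > 0, β * (τ * p) ≤ τ ^ 2 * b + a) {c : ℝ}
    (hc : 1 ≤ c) : β * (c * Real.log c) * p ≤ (c - 1) * (a + c * b) := by
  set f : ℝ → ℝ := fun τ => a * (1 - τ⁻¹) + b * (τ - 1) - β * p * Real.log τ with hf
  have hd : ∀ τ : ℝ, 0 < τ →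
      HasDerivAt f (a * (-(-(τ ^ 2)⁻¹)) + b * 1 - β * p * τ⁻¹) τ := fun τ hτ =>
    ((((hasDerivAt_inv hτ.ne').const_sub 1).const_mul a).add
      (((hasDerivAt_id τ).sub_const 1).const_mul b)).sub
      ((Real.hasDerivAt_log hτ.ne').const_mul (β * p))
  have hmono : MonotoneOn f (Icc 1 c) := by
    refine monotoneOn_of_deriv_nonneg (convex_Icc _ _)
      (fun τ hτ => (hd τ (by linarith [hτ.1])).continuousAt.continuousWithinAt)
      (fun τ hτ => ?_) (fun τ hτ => ?_)
    · rw [interior_Icc] at hτ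
      exact (hd τ (by linarith [hτ.1])).differentiableAt.differentiableWithinAt
    · rw [interior_Icc] at hτ
      have hτ0 : 0 < τ := by linarith [hτ.1]
      rw [(hd τ hτ0).deriv]
      have h1 := h τ hτ0
      have : a * (-(-(τ ^ 2)⁻¹)) + b * 1 - β * p * τ⁻¹ =
          (τ ^ 2 * b + a - β * (τ * p)) / τ ^ 2 := by field_simp; ring
      rw [this]
      exact div_nonneg (by linarith) (by positivity)
  have h1 := hmono ⟨le_rfl, hc⟩ ⟨hc, le_rfl⟩ hc
  have hc0 : 0 < c := by linarith
  have h2 : f 1 = 0 := by simp [hf]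
  rw [h2] at h1
  have h3 : c * f c = (c - 1) * (a + c * b) - β * (c * Real.log c) * p := by
    simp only [hf]; field_simp
  nlinarith [mul_nonneg hc0.le h1]

/-- Both sides vanish at `c = 1`, so their derivatives there are ordered in the same way. -/
lemma le_of_forall_mul_log_le {a b p β : ℝ}
    (h : ∀ c > 1, β * (c * Real.log c) * p ≤ (c - 1) * (a + c * b)) : β * p ≤ a + b := by
  have hd : HasDerivAt (fun c : ℝ => (c - 1) * (a + c * b) - β * (c * Real.log c) * p)
      ((1 * (a + 1 * b) + (1 - 1) * (1 * b)) - β * (1 * Real.log 1 + 1 * (1 : ℝ)⁻¹) * p) 1 :=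
    (((hasDerivAt_id (1 : ℝ)).sub_const 1).mul
      (((hasDerivAt_id (1 : ℝ)).mul_const b).const_add a)).sub
      ((((hasDerivAt_id (1 : ℝ)).mul (Real.hasDerivAt_log one_ne_zero)).const_mul β).mul_const p)
  have := deriv_nonneg_of_nonneg (s := 1) (b := 2) one_lt_two hd.hasDerivWithinAt (by simp)
    fun c hc => by
      rcases eq_or_lt_of_le hc.1 with rfl | h1
      · simp
      · exact sub_nonneg.2 (h c h1)
  simp at this
  linarith

variable {𝕜 E : Type*} [RCLike 𝕜] [NormedAddCommGroup E] [InnerProductSpace 𝕜 E]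
  {A D S : ℝ → E →L[𝕜] E}

lemma isSelfAdjoint_mul_mul [CompleteSpace E] {P T : E →L[𝕜] E} (hP : IsSelfAdjoint P) (hT : IsSelfAdjoint T) :
    IsSelfAdjoint (P * T * P) := by
  rw [isSelfAdjoint_iff, star_mul, star_mul, hP.star_eq, hT.star_eq, mul_assoc]

lemma quadForm_mul_smul_mul [NormedSpace ℝ E] [IsScalarTower ℝ 𝕜 E] (c t : ℝ)
    (P : E →L[𝕜] E) (x : E) :
    quadForm ((c • P) * S t * (c • P)) x = c ^ 2 * quadForm (P * S t * P) x := by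
  rw [smul_mul_assoc, smul_mul_assoc, mul_smul_comm, smul_smul, quadForm_smul, sq]

variable [CompleteSpace E] [NormedSpace ℝ E] [IsScalarTower ℝ 𝕜 E]

lemma mem_riccatiRates_iff (hD_sym : ∀ t, D t ∈ symOps 𝕜 E) (hS_sym : ∀ t, S t ∈ symOps 𝕜 E)
    {β : ℝ} : β ∈ riccatiRates D S ↔ ∀ t, 0 ≤ t → ∀ P ∈ posInvOps 𝕜 E, ∀ x,
      β * quadForm P x ≤ quadForm (P * S t * P) x + quadForm (D t) x := by
  refine forall_congr' fun t => forall_congr' fun _ => forall_congr' fun P =>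
    forall_congr' fun hP => ?_
  rw [le_iff_quadForm (isSelfAdjoint_smul hP.1.isSelfAdjoint β)
    ((isSelfAdjoint_mul_mul hP.1.isSelfAdjoint (hS_sym t)).add (hD_sym t))]
  simp

lemma riccatiField_smul (c t : ℝ) (P : E →L[𝕜] E) :
    riccatiField A D S t (c • P) =
      c • riccatiField A D S t P - (c - 1) • (D t + c • (P * S t * P)) := by
  simp only [riccatiField, mul_smul_comm, smul_mul_assoc]
  module

/-- One half of the contraction estimate: an order bound between two solutions contracts. -/
theorem quadForm_le_exp_mul (hA : Continuous A) (hS : Continuous S)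
    (hD_sym : ∀ t, D t ∈ symOps 𝕜 E) (hS_sym : ∀ t, S t ∈ symOps 𝕜 E) {β : ℝ}
    (hβ : β ∈ riccatiRates D S) {s b : ℝ} (hs : 0 ≤ s) {P Q : ℝ → E →L[𝕜] E}
    (hP : IsSolution (riccatiField A D S) (symOps 𝕜 E) s b P)
    (hQ : IsSolution (riccatiField A D S) (symOps 𝕜 E) s b Q)
    (hQU : ∀ t ∈ Ico s b, Q t ∈ posInvOps 𝕜 E) {d : ℝ} (hd : 0 ≤ d)
    (h0 : ∀ x, quadForm (P s) x ≤ Real.exp d * quadForm (Q s) x) {t : ℝ} (ht : t ∈ Ico s b)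
    (x : E) :
    quadForm (P t) x ≤ Real.exp (Real.exp (-β * (t - s)) * d) * quadForm (Q t) x := by
  have hμ : ∀ τ : ℝ, HasDerivAt (fun τ => Real.exp (-β * (τ - s)) * d)
      (Real.exp (-β * (τ - s)) * -β * d) τ := fun τ => by
    have : HasDerivAt (fun τ : ℝ => -β * (τ - s)) (-β) τ := by
      simpa using ((hasDerivAt_id τ).sub_const s).const_mul (-β)
    exact this.exp.mul_const d
  -- With `λ = e^l`, the supersolution property of `λQ` reduces by `riccatiField_smul` to `β λ log λ
  -- Q ≤ (λ - 1)(D + λ QΣQ)`, which is `mul_log_le_of_forall` applied to the forms at `y`.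
  have h := quadForm_le_of_supersolution (D := D) hA hS hS_sym
    (Q := fun τ => Real.exp (Real.exp (-β * (τ - s)) * d) • Q τ)
    hP (fun τ hτ => isSelfAdjoint_smul (hQ τ hτ).1 _)
    (fun τ hτ => (hμ τ).exp.hasDerivWithinAt.smul (hQ τ hτ).2)
    (fun τ hτ y => ?_) (fun y => by simpa using h0 y) ht x
  · simpa using h
  · set l : ℝ := Real.exp (-β * (τ - s)) * d with hl
    have hl0 : 0 ≤ l := by positivity
    have hc : 1 ≤ Real.exp l := Real.one_le_exp hl0
    have hm := mul_log_le_of_forall (a := quadForm (D τ) y)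
      (b := quadForm (Q τ * S τ * Q τ) y) (p := quadForm (Q τ) y) (β := β) (fun c hc => by
        have := (mem_riccatiRates_iff hD_sym hS_sym).1 hβ τ (hs.trans hτ.1) _
          (smul_mem_posInvOps (hQU τ hτ) hc) y
        rwa [quadForm_mul_smul_mul, quadForm_smul] at this) hc
    rw [Real.log_exp] at hm
    rw [riccatiField_smul]
    simp only [quadForm_sub, quadForm_add, quadForm_smul]
    have e : Real.exp l * (Real.exp (-β * (τ - s)) * -β * d) = -(β * (Real.exp l * l)) := by
      rw [hl]; ring
    rw [e]
    linarith

theorem contractsAtRate_of_mem_riccatiRates [Nontrivial E] (hA : Continuous A) (hS : Continuous S)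
    (hD_sym : ∀ t, D t ∈ symOps 𝕜 E) (hS_sym : ∀ t, S t ∈ symOps 𝕜 E) {β : ℝ}
    (hβ : β ∈ riccatiRates D S) :
    ContractsAtRate (riccatiField A D S) (symOps 𝕜 E) (posInvOps 𝕜 E) β := by
  intro P₁ hP₁ P₂ hP₂ s t hs hst ht
  obtain ⟨b₁, htb₁, x₁, hx₁, rfl, hU₁⟩ := exists_solution_of_lt_exitTime (lt_min_iff.1 ht).1
  obtain ⟨b₂, htb₂, x₂, hx₂, rfl, hU₂⟩ := exists_solution_of_lt_exitTime (lt_min_iff.1 ht).2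
  rw [flow_eq hA hS hS_sym hx₁ ⟨hst, htb₁⟩, flow_eq hA hS hS_sym hx₂ ⟨hst, htb₂⟩]
  have ht' : t ∈ Ico s (min b₁ b₂) := ⟨hst, lt_min htb₁ htb₂⟩
  have hx₁' := isSolution_mono hx₁ (min_le_left b₁ b₂)
  have hx₂' := isSolution_mono hx₂ (min_le_right b₁ b₂)
  have hd := thompsonDist_nonneg hP₁ hP₂
  refine thompsonDist_le (hU₁ t ⟨hst, htb₁⟩) (hU₂ t ⟨hst, htb₂⟩) (fun x => ?_) fun x => ?_
  · exact quadForm_le_exp_mul hA hS hD_sym hS_sym hβ hs hx₁' hx₂'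
      (fun τ hτ => hU₂ τ ⟨hτ.1, hτ.2.trans_le (min_le_right _ _)⟩) hd
      (quadForm_le_exp_thompsonDist_mul hP₁ hP₂) ht' x
  · refine quadForm_le_exp_mul hA hS hD_sym hS_sym hβ hs hx₂' hx₁'
      (fun τ hτ => hU₁ τ ⟨hτ.1, hτ.2.trans_le (min_le_left _ _)⟩) hd (fun y => ?_) ht' x
    rw [thompsonDist_comm]
    exact quadForm_le_exp_thompsonDist_mul hP₂ hP₁ y

theorem mem_riccatiRates_of_contractsAtRate [Nontrivial E] (hA : Continuous A) (hD : Continuous D)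
    (hS : Continuous S) (hA_bdd : ∃ C : ℝ, ∀ t, ‖A t‖ ≤ C) (hD_bdd : ∃ C : ℝ, ∀ t, ‖D t‖ ≤ C)
    (hS_bdd : ∃ C : ℝ, ∀ t, ‖S t‖ ≤ C) (hD_sym : ∀ t, D t ∈ symOps 𝕜 E)
    (hS_sym : ∀ t, S t ∈ symOps 𝕜 E) {α : ℝ}
    (hα : ContractsAtRate (riccatiField A D S) (symOps 𝕜 E) (posInvOps 𝕜 E) α) :
    α ∈ riccatiRates D S := by
  rw [mem_riccatiRates_iff hD_sym hS_sym]
  intro s hs P hP x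
  rw [add_comm]
  refine le_of_forall_mul_log_le fun c hc => ?_
  have hc0 : 0 < c := by linarith
  have hcP := smul_mem_posInvOps hP hc0
  obtain ⟨b₁, hb₁, x₁, hx₁0, hx₁, hU₁⟩ :=
    exists_isSolution_posInvOps hA hD hS hA_bdd hD_bdd hS_bdd hD_sym hS_sym s hcP
  obtain ⟨b₂, hb₂, x₂, hx₂0, hx₂, hU₂⟩ :=
    exists_isSolution_posInvOps hA hD hS hA_bdd hD_bdd hS_bdd hD_sym hS_sym s hP
  have hb : s < min b₁ b₂ := lt_min hb₁ hb₂
  have hx₁' := (isSolution_mono hx₁ (min_le_left b₁ b₂) s ⟨le_rfl, hb⟩).2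
  have hx₂' := (isSolution_mono hx₂ (min_le_right b₁ b₂) s ⟨le_rfl, hb⟩).2
  have hμ : HasDerivAt (fun τ => Real.exp (-α * (τ - s)) * Real.log c)
      (Real.exp (-α * (s - s)) * -α * Real.log c) s := by
    have : HasDerivAt (fun τ : ℝ => -α * (τ - s)) (-α) s := by
      simpa using ((hasDerivAt_id s).sub_const s).const_mul (-α)
    exact this.exp.mul_const _
  -- The function `exp(e^{-α(t-s)} log c) x₂(t) - x₁(t)`, tested on `x`, is zero at `t = s` and
  -- nonnegative afterwards by contraction. Nonnegativity of its right derivative is the wanted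
  -- inequality in `c`.
  have hder := (quadFormCLM 𝕜 x).hasFDerivAt.comp_hasDerivWithinAt s
    ((hμ.exp.hasDerivWithinAt.smul hx₂').sub hx₁')
  have hnn := deriv_nonneg_of_nonneg hb hder
    (by simp [hx₁0, hx₂0, Real.exp_log hc0]) (fun t ht => ?_)
  · simp only [sub_self, mul_zero, Real.exp_zero, one_mul, Real.exp_log hc0, hx₁0, hx₂0,
      quadFormCLM_apply] at hnn
    rw [riccatiField_smul] at hnn
    simp only [quadForm_sub, quadForm_add, quadForm_smul] at hnn
    linarith
  · have ht₁ : t ∈ Ico s b₁ := ⟨ht.1, ht.2.trans_le (min_le_left _ _)⟩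
    have ht₂ : t ∈ Ico s b₂ := ⟨ht.1, ht.2.trans_le (min_le_right _ _)⟩
    have hlt₁ := lt_exitTime ht₁ hx₁ hU₁
    have hlt₂ := lt_exitTime ht₂ hx₂ hU₂
    have hf₁ := flow_eq hA hS hS_sym hx₁ ht₁
    have hf₂ := flow_eq hA hS hS_sym hx₂ ht₂
    rw [hx₁0] at hlt₁ hf₁
    rw [hx₂0] at hlt₂ hf₂
    have hcon := hα _ hcP _ hP s t hs ht.1 (lt_min hlt₁ hlt₂)
    rw [hf₁, hf₂] at hcon
    have hle : thompsonDist (x₁ t) (x₂ t) ≤ Real.exp (-α * (t - s)) * Real.log c :=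
      hcon.trans (mul_le_mul_of_nonneg_left (thompsonDist_smul_le hP hc.le) (Real.exp_pos _).le)
    have h1 := quadForm_le_exp_thompsonDist_mul (hU₁ t ht₁) (hU₂ t ht₂) x
    have h2 := mul_le_mul_of_nonneg_right (Real.exp_le_exp.2 hle) ((hU₂ t ht₂).1.quadForm_nonneg x)
    have h3 : 0 ≤ Real.exp (Real.exp (-α * (t - s)) * Real.log c) * quadForm (x₂ t) x -
        quadForm (x₁ t) x := by linarith
    simpa using h3

theorem contractsAtRate_iff [Nontrivial E] (hA : Continuous A) (hD : Continuous D)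
    (hS : Continuous S) (hA_bdd : ∃ C : ℝ, ∀ t, ‖A t‖ ≤ C) (hD_bdd : ∃ C : ℝ, ∀ t, ‖D t‖ ≤ C)
    (hS_bdd : ∃ C : ℝ, ∀ t, ‖S t‖ ≤ C) (hD_sym : ∀ t, D t ∈ symOps 𝕜 E)
    (hS_sym : ∀ t, S t ∈ symOps 𝕜 E) :
    {α : ℝ | ContractsAtRate (riccatiField A D S) (symOps 𝕜 E) (posInvOps 𝕜 E) α} =
      riccatiRates D S :=
  Subset.antisymm
    (fun _ => mem_riccatiRates_of_contractsAtRate hA hD hS hA_bdd hD_bdd hS_bdd hD_sym hS_sym)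
    (fun _ => contractsAtRate_of_mem_riccatiRates hA hS hD_sym hS_sym)

end ContractionRate

section ExplicitRate

/-! ### The supremum of the rates and its explicit form -/

variable {𝕜 E : Type*} [RCLike 𝕜] [NormedAddCommGroup E] [InnerProductSpace 𝕜 E]
  {D S : ℝ → E →L[𝕜] E}

lemma one_mem_posInvOps : (1 : E →L[𝕜] E) ∈ posInvOps 𝕜 E := ⟨isPositive_one, isUnit_one⟩

variable [CompleteSpace E]

/-- A self-adjoint operator that is bounded below is surjective. -/
lemma surjective_of_norm_le {R : E →L[𝕜] E} (hR : IsSelfAdjoint R) {c : ℝ} (hc : 0 < c)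
    (h : ∀ x, c * ‖x‖ ^ 2 ≤ ‖R x‖ ^ 2) : Function.Surjective R := by
  have hU : R * R ∈ posInvOps 𝕜 E := by
    refine mem_posInvOps_iff.2 ⟨by rw [isSelfAdjoint_iff, star_mul, hR.star_eq], c, hc, fun x => ?_⟩
    have := quadForm_conj_selfAdjoint hR 1 x
    rw [mul_one, quadForm_one] at this
    rw [this]
    exact h x
  obtain ⟨u, hu⟩ := hU.2
  intro y
  refine ⟨R ((↑u⁻¹ : E →L[𝕜] E) y), ?_⟩
  have h1 : R * R * (↑u⁻¹ : E →L[𝕜] E) = 1 := by rw [← hu]; exact u.mul_inv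
  exact congrArg (fun T : E →L[𝕜] E => T y) h1

variable [NormedSpace ℝ E] [IsScalarTower ℝ 𝕜 E]

lemma bddAbove_riccatiRates [Nontrivial E] (hD_sym : ∀ t, D t ∈ symOps 𝕜 E)
    (hS_sym : ∀ t, S t ∈ symOps 𝕜 E) : BddAbove (riccatiRates D S) := by
  obtain ⟨x, hx⟩ := exists_pos_quadForm (one_mem_posInvOps (𝕜 := 𝕜) (E := E))
  refine ⟨(quadForm (1 * S 0 * 1) x + quadForm (D 0) x) / quadForm (1 : E →L[𝕜] E) x,
    fun β hβ => ?_⟩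
  rw [le_div_iff₀ hx]
  exact (mem_riccatiRates_iff hD_sym hS_sym).1 hβ 0 le_rfl 1 one_mem_posInvOps x

lemma isGreatest_sSup_riccatiRates [Nontrivial E] (hD_sym : ∀ t, D t ∈ symOps 𝕜 E)
    (hS_sym : ∀ t, S t ∈ symOps 𝕜 E) (hne : (riccatiRates D S).Nonempty) :
    IsGreatest (riccatiRates D S) (sSup (riccatiRates D S)) := by
  have hbdd := bddAbove_riccatiRates hD_sym hS_sym
  have hcl : IsClosed (riccatiRates D S) := by
    have : riccatiRates D S = ⋂ (t : ℝ) (_ : 0 ≤ t) (P ∈ posInvOps 𝕜 E) (x : E),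
        {β : ℝ | β * quadForm P x ≤ quadForm (P * S t * P) x + quadForm (D t) x} := by
      ext β
      rw [mem_riccatiRates_iff hD_sym hS_sym]
      simp
    rw [this]
    exact isClosed_iInter fun t => isClosed_iInter fun _ => isClosed_iInter fun P =>
      isClosed_iInter fun _ => isClosed_iInter fun x =>
        isClosed_le (by fun_prop) continuous_const
  exact ⟨hcl.csSup_mem hne hbdd, fun β hβ => le_csSup hbdd hβ⟩

lemma coe_sSup_of_isGreatest {s : Set ℝ} {a : ℝ} (h : IsGreatest s a) :
    sSup ((fun β : ℝ => (β : EReal)) '' s) = (a : EReal) :=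
  IsLUB.sSup_eq (IsGreatest.isLUB ⟨mem_image_of_mem _ h.1,
    forall_mem_image.2 fun _ hβ => EReal.coe_le_coe_iff.2 (h.2 hβ)⟩)

lemma lowerRatio_one_spec [Nontrivial E] {T : E →L[𝕜] E} (hT : IsSelfAdjoint T) {m : ℝ} :
    m ≤ lowerRatio T (1 : E →L[𝕜] E) ↔ ∀ x, m * ‖x‖ ^ 2 ≤ quadForm T x := by
  have hset : {t : ℝ | t • (1 : E →L[𝕜] E) ≤ T} =
      ⋂ x, {t : ℝ | t * ‖x‖ ^ 2 ≤ quadForm T x} := by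
    ext t
    rw [mem_iInter]
    change t • (1 : E →L[𝕜] E) ≤ T ↔ _
    rw [le_iff_quadForm (isSelfAdjoint_smul (IsSelfAdjoint.one _) t) hT]
    simp
  have hcl : IsClosed {t : ℝ | t • (1 : E →L[𝕜] E) ≤ T} := by
    rw [hset]
    exact isClosed_iInter fun x => isClosed_le (by fun_prop) continuous_const
  have hmem : ∀ t : ℝ, t ∈ {t : ℝ | t • (1 : E →L[𝕜] E) ≤ T} ↔
      ∀ x, t * ‖x‖ ^ 2 ≤ quadForm T x := by
    intro t; rw [hset]; simp
  have hbdd : BddAbove {t : ℝ | t • (1 : E →L[𝕜] E) ≤ T} := by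
    obtain ⟨x, hx⟩ := exists_pos_quadForm (one_mem_posInvOps (𝕜 := 𝕜) (E := E))
    rw [quadForm_one] at hx
    refine ⟨quadForm T x / ‖x‖ ^ 2, fun t ht => ?_⟩
    rw [le_div_iff₀ hx]
    exact (hmem t).1 ht x
  have hne : {t : ℝ | t • (1 : E →L[𝕜] E) ≤ T}.Nonempty :=
    ⟨-‖T‖, (hmem _).2 fun x => by linarith [neg_le_quadForm T x]⟩
  constructor
  · intro hm x
    exact (mul_le_mul_of_nonneg_right hm (by positivity)).trans
      ((hmem _).1 (hcl.csSup_mem hne hbdd) x)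
  · exact fun h => le_csSup hbdd ((hmem m).2 h)

lemma isSelfAdjoint_opSqrt_conj {T R : E →L[𝕜] E} (hT : T.IsPositive) (hR : IsSelfAdjoint R) :
    IsSelfAdjoint (opSqrt T * R * opSqrt T) :=
  isSelfAdjoint_mul_mul (opSqrt_spec hT).1.isSelfAdjoint hR

lemma quadForm_eq_norm_opSqrt_sq {T : E →L[𝕜] E} (hT : T.IsPositive) (x : E) :
    quadForm T x = ‖opSqrt T x‖ ^ 2 := by
  obtain ⟨hR, hRR⟩ := opSqrt_spec hT
  conv_lhs => rw [← hRR]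
  rw [quadForm, mul_apply_eq_comp, hR.inner_left_eq_inner_right, inner_self_eq_norm_sq]

/-- If `R D R ≥ (β / 2)² I` with `R = Σ^{1/2}` then `P Σ P + D ≥ β P` for all positive `P`. -/
lemma rate_le_of_lowerBound {D₀ S₀ : E →L[𝕜] E} (hS : S₀.IsPositive) {β : ℝ} (hβ : 0 < β)
    (h : ∀ x, (β / 2) ^ 2 * ‖x‖ ^ 2 ≤ quadForm (opSqrt S₀ * D₀ * opSqrt S₀) x)
    {P : E →L[𝕜] E} (hP : IsSelfAdjoint P) (x : E) :
    β * quadForm P x ≤ quadForm (P * S₀ * P) x + quadForm D₀ x := by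
  obtain ⟨hR, hRR⟩ := opSqrt_spec hS
  set R := opSqrt S₀ with hR_def
  have hRs : IsSelfAdjoint R := hR.isSelfAdjoint
  have hform : ∀ y, quadForm (R * D₀ * R) y = quadForm D₀ (R y) :=
    quadForm_conj_selfAdjoint hRs D₀
  have hsurj : Function.Surjective R := by
    -- The hypothesis reads `(β/2)²‖y‖² ≤ quadForm D₀ (R y) ≤ ‖D₀‖ ‖R y‖²`, so `R` is bounded below
    -- and every `x` has the form `R y`.
    refine surjective_of_norm_le hRs (c := (β / 2) ^ 2 / (‖D₀‖ + 1)) (by positivity) fun y => ?_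
    rw [div_mul_eq_mul_div, div_le_iff₀ (by positivity)]
    calc (β / 2) ^ 2 * ‖y‖ ^ 2 ≤ quadForm D₀ (R y) := by rw [← hform]; exact h y
      _ ≤ ‖D₀‖ * ‖R y‖ ^ 2 := quadForm_le _ _
      _ ≤ ‖R y‖ ^ 2 * (‖D₀‖ + 1) := by nlinarith [sq_nonneg ‖R y‖]
  obtain ⟨y, rfl⟩ := hsurj x
  have h1 : quadForm (P * S₀ * P) (R y) = ‖R (P (R y))‖ ^ 2 := by
    rw [quadForm_conj_selfAdjoint hP, quadForm_eq_norm_opSqrt_sq hS]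
  have h2 : quadForm P (R y) ≤ ‖R (P (R y))‖ * ‖y‖ := by
    rw [quadForm, ← hR.inner_left_eq_inner_right]
    exact (RCLike.re_le_norm _).trans (norm_inner_le_norm _ _)
  have h3 := h y
  rw [hform] at h3
  rw [h1]
  -- Completed square: `β ‖RPRy‖ ‖y‖ ≤ ‖RPRy‖² + (β/2)²‖y‖²`.
  nlinarith [mul_le_mul_of_nonneg_left h2 hβ.le, sq_nonneg (‖R (P (R y))‖ - β / 2 * ‖y‖)]

/-- If `P Σ P + D ≥ β P` for all positive invertible `P`, then `Σ D Σ ≥ (β / 2)² Σ`, even after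
`Σ` is replaced by `Σ + ε I`. -/
lemma shifted_lowerBound_of_rate {D₀ S₀ : E →L[𝕜] E} (hS : S₀.IsPositive) {β : ℝ} (hβ : 0 < β)
    (h : ∀ P ∈ posInvOps 𝕜 E, ∀ x,
      β * quadForm P x ≤ quadForm (P * S₀ * P) x + quadForm D₀ x)
    {ε : ℝ} (hε : 0 < ε) (y : E) :
    (β / 2) ^ 2 * (quadForm S₀ y + ε * ‖y‖ ^ 2) ≤ quadForm D₀ ((S₀ + ε • (1 : E →L[𝕜] E)) y) := by
  set T : E →L[𝕜] E := S₀ + ε • (1 : E →L[𝕜] E) with hT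
  have hTs : IsSelfAdjoint T := hS.isSelfAdjoint.add (isSelfAdjoint_smul (IsSelfAdjoint.one _) ε)
  have hTq : ∀ x, quadForm T x = quadForm S₀ x + ε * ‖x‖ ^ 2 := fun x => by simp [hT]
  have hTU : T ∈ posInvOps 𝕜 E := mem_posInvOps_iff.2 ⟨hTs, ε, hε, fun x => by
    rw [hTq]; linarith [hS.quadForm_nonneg x]⟩
  obtain ⟨u, hu⟩ := hTU.2
  set V : E →L[𝕜] E := (↑u⁻¹ : E →L[𝕜] E) with hV
  have hVT : V * T = 1 := by rw [← hu]; exact u.inv_mul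
  have hTV : T * V = 1 := by rw [← hu]; exact u.mul_inv
  have hVs : IsSelfAdjoint V := by
    have h1 : star V * T = 1 := by rw [← hTs.star_eq, ← star_mul, hTV, star_one]
    calc star V = star V * (T * V) := by rw [hTV, mul_one]
      _ = V := by rw [← mul_assoc, h1, one_mul]
  have hVTy : ∀ x, V (T x) = x := fun x => congrArg (fun T : E →L[𝕜] E => T x) hVT
  have hVq : ∀ x, quadForm V (T x) = quadForm T x := fun x => by
    rw [quadForm, hVTy, quadForm, ← hTU.1.inner_left_eq_inner_right]
  have hTVx : ∀ x, T (V x) = x := fun x => congrArg (fun T : E →L[𝕜] E => T x) hTV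
  have hVp : V.IsPositive := (isPositive_iff_quadForm hVs).2 fun x => by
    rw [← hTVx x, hVq]; exact hTU.1.quadForm_nonneg _
  have hVU : V ∈ posInvOps 𝕜 E := ⟨hVp, u⁻¹.isUnit⟩
  -- The test operator is `(β/2) T⁻¹` at the vector `T y`: the left side becomes `(β²/2) quadForm T
  -- y`, and the quadratic term becomes `(β/2)² quadForm S₀ y`.
  have hk := h _ (smul_mem_posInvOps hVU (half_pos hβ)) (T y)
  rw [smul_mul_assoc, smul_mul_assoc, mul_smul_comm, smul_smul, quadForm_smul, quadForm_smul,
    quadForm_conj_selfAdjoint hVs, hVTy, hVq, hTq] at hk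
  have : 0 ≤ ε * ‖y‖ ^ 2 := by positivity
  nlinarith [mul_nonneg (sq_nonneg (β / 2)) this]

/-- Letting `ε` tend to `0` in the shifted bound gives the claim for `z` in the range of `R =
S₀^{1/2}`. That range is dense because `R` is self-adjoint and injective, so continuity gives all
`z`. -/
lemma lowerBound_of_rate {D₀ S₀ : E →L[𝕜] E} (hS : S₀.IsPositive) {β : ℝ} (hβ : 0 < β)
    (h : ∀ P ∈ posInvOps 𝕜 E, ∀ x,
      β * quadForm P x ≤ quadForm (P * S₀ * P) x + quadForm D₀ x) (z : E) :
    (β / 2) ^ 2 * ‖z‖ ^ 2 ≤ quadForm (opSqrt S₀ * D₀ * opSqrt S₀) z := by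
  obtain ⟨hR, hRR⟩ := opSqrt_spec hS
  have hSR : ∀ y, S₀ y = opSqrt S₀ (opSqrt S₀ y) := fun y => by
    conv_lhs => rw [← hRR]
    rfl
  have hqR := quadForm_eq_norm_opSqrt_sq hS
  set R := opSqrt S₀ with hR_def
  have hRs : IsSelfAdjoint R := hR.isSelfAdjoint
  have hβ2 : 0 < (β / 2) ^ 2 := by positivity
  have hker : ∀ y, R y = 0 → y = 0 := by
    intro y hy
    have hSy : S₀ y = 0 := by rw [hSR, hy, map_zero]
    by_contra hy0
    have hn : 0 < ‖y‖ ^ 2 := by have := norm_pos_iff.2 hy0; positivity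
    -- On a kernel vector the shifted bound reads `(β/2)² ε‖y‖² ≤ quadForm D₀ (εy) ≤ ‖D₀‖ ε²‖y‖²`,
    -- which this `ε` violates unless `y = 0`.
    set ε : ℝ := (β / 2) ^ 2 / (‖D₀‖ + 1) with hε
    have hε0 : 0 < ε := by positivity
    have h1 := shifted_lowerBound_of_rate hS hβ h hε0 y
    have h2 : (S₀ + ε • (1 : E →L[𝕜] E)) y = (ε : 𝕜) • y := by
      rw [real_smul_op_eq, add_apply, hSy, zero_add, smul_apply, one_apply_eq_self]
    have h3 := quadForm_le D₀ ((ε : 𝕜) • y)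
    rw [norm_smul, RCLike.norm_ofReal, abs_of_pos hε0] at h3
    rw [h2, hqR, hy, norm_zero] at h1
    have h4 : (β / 2) ^ 2 = ε * (‖D₀‖ + 1) := by rw [hε]; field_simp
    rw [h4] at h1
    nlinarith [mul_pos (mul_pos hε0 hε0) hn]
  have hdense : DenseRange R := by
    have hK : (LinearMap.range (R : E →ₗ[𝕜] E))ᗮ = ⊥ := by
      rw [Submodule.eq_bot_iff]
      intro y hy
      refine hker y (ext_inner_left 𝕜 fun v => ?_)
      rw [inner_zero_right, ← hR.inner_left_eq_inner_right]
      exact hy _ ⟨v, rfl⟩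
    have := (Submodule.topologicalClosure_eq_top_iff).2 hK
    rw [← Submodule.dense_iff_topologicalClosure_eq_top] at this
    exact this
  have hrange : ∀ y, (β / 2) ^ 2 * ‖R y‖ ^ 2 ≤ quadForm D₀ (S₀ y) := by
    intro y
    have hc : Continuous fun ε : ℝ => quadForm D₀ ((S₀ + ε • (1 : E →L[𝕜] E)) y) := by
      have : (fun ε : ℝ => quadForm D₀ ((S₀ + ε • (1 : E →L[𝕜] E)) y)) = fun ε : ℝ =>
          RCLike.re ⟪D₀ (S₀ y + ((ε : ℝ) : 𝕜) • y), S₀ y + ((ε : ℝ) : 𝕜) • y⟫_𝕜 := by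
        funext ε
        rw [real_smul_op_eq]; rfl
      rw [this]
      fun_prop
    have hl1 : Tendsto (fun ε : ℝ => (β / 2) ^ 2 * (quadForm S₀ y + ε * ‖y‖ ^ 2)) (𝓝[>] 0)
        (𝓝 ((β / 2) ^ 2 * (quadForm S₀ y + 0 * ‖y‖ ^ 2))) :=
      (Continuous.tendsto (by fun_prop) 0).mono_left nhdsWithin_le_nhds
    have hl2 := (hc.tendsto 0).mono_left (nhdsWithin_le_nhds (s := Ioi (0 : ℝ)))
    have := le_of_tendsto_of_tendsto hl1 hl2
      (eventually_mem_nhdsWithin.mono fun ε hε => shifted_lowerBound_of_rate hS hβ h hε y)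
    simpa [hqR] using this
  rw [quadForm_conj_selfAdjoint hRs]
  refine hdense.induction_on (p := fun z => (β / 2) ^ 2 * ‖z‖ ^ 2 ≤ quadForm D₀ (R z)) z
    (isClosed_le (by fun_prop) (by unfold quadForm; fun_prop)) fun y => ?_
  rw [← hSR]
  exact hrange y

/-- Nonpositive `β` lie in both sets by positivity. For `β > 0` the condition can be checked
separately at each `t`, where it says that `β/2` is at most the square root at that time. -/
theorem riccatiRates_eq_Iic [Nontrivial E]
    (hpos : ∀ t, 0 ≤ t → (D t).IsPositive ∧ (S t).IsPositive)
    (hD_sym : ∀ t, D t ∈ symOps 𝕜 E) (hS_sym : ∀ t, S t ∈ symOps 𝕜 E) :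
    riccatiRates D S = Iic (2 * ⨅ t : Ici (0 : ℝ), Real.sqrt (lowerRatio
      (opSqrt (S t) * D t * opSqrt (S t)) (1 : E →L[𝕜] E))) := by
  set m : Ici (0 : ℝ) → ℝ := fun t => Real.sqrt (lowerRatio
      (opSqrt (S t) * D t * opSqrt (S t)) (1 : E →L[𝕜] E)) with hm
  have hbdd : BddBelow (range m) := ⟨0, forall_mem_range.2 fun t => Real.sqrt_nonneg _⟩
  have hinf : 0 ≤ ⨅ t, m t := Real.iInf_nonneg fun t => Real.sqrt_nonneg _
  have hzero : ∀ β ≤ 0, β ∈ riccatiRates D S := by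
    intro β hβ
    refine (mem_riccatiRates_iff hD_sym hS_sym).2 fun t ht P hP x => ?_
    have h1 := hP.1.quadForm_nonneg x
    have h2 := (hpos t ht).1.quadForm_nonneg x
    have h3 := (hpos t ht).2.quadForm_nonneg (P x)
    rw [quadForm_conj_selfAdjoint hP.1.isSelfAdjoint]
    nlinarith
  ext β
  rw [mem_Iic]
  rcases le_or_gt β 0 with hβ | hβ
  · exact ⟨fun _ => by linarith, fun _ => hzero β hβ⟩
  have hmt : ∀ t : Ici (0 : ℝ), β / 2 ≤ m t ↔
      ∀ x, (β / 2) ^ 2 * ‖x‖ ^ 2 ≤ quadForm (opSqrt (S t) * D t * opSqrt (S t)) x := by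
    intro t
    rw [hm, Real.le_sqrt' (half_pos hβ),
      lowerRatio_one_spec (isSelfAdjoint_opSqrt_conj (hpos t t.2).2 (hD_sym t))]
  rw [mem_riccatiRates_iff hD_sym hS_sym]
  constructor
  · intro h
    have : β / 2 ≤ ⨅ t, m t := le_ciInf fun t =>
      (hmt t).2 (lowerBound_of_rate (hpos t t.2).2 hβ (h t t.2))
    linarith
  · intro h t ht P hP x
    have hle : β / 2 ≤ m ⟨t, ht⟩ := le_trans (by linarith) (ciInf_le hbdd ⟨t, ht⟩)
    exact rate_le_of_lowerBound (hpos t ht).2 hβ ((hmt ⟨t, ht⟩).1 hle)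
      hP.1.isSelfAdjoint x

end ExplicitRate

end Riccati

end

theorem mainTheorem10 {𝕜 E : Type*} [RCLike 𝕜] [NormedAddCommGroup E] [InnerProductSpace 𝕜 E]
    [CompleteSpace E] [Nontrivial E] [NormedSpace ℝ E] [IsScalarTower ℝ 𝕜 E]
    (A D S : ℝ → E →L[𝕜] E)
    (hA : Continuous A) (hD : Continuous D) (hS : Continuous S)
    (hA_bdd : ∃ C : ℝ, ∀ t, ‖A t‖ ≤ C) (hD_bdd : ∃ C : ℝ, ∀ t, ‖D t‖ ≤ C)
    (hS_bdd : ∃ C : ℝ, ∀ t, ‖S t‖ ≤ C)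
    (hD_sym : ∀ t, D t ∈ Riccati.symOps 𝕜 E) (hS_sym : ∀ t, S t ∈ Riccati.symOps 𝕜 E) :
    -- the best contraction rate is the supremum, in `[-∞, +∞]`
    Riccati.bestContractionRate (Riccati.riccatiField A D S)
        (Riccati.symOps 𝕜 E) (Riccati.posInvOps 𝕜 E) =
      sSup ((fun β : ℝ => (β : EReal)) '' Riccati.riccatiRates D S) ∧
    -- when it is not `-∞`, it is finite and is itself an admissible rate
    ((Riccati.riccatiRates D S).Nonempty →
      IsGreatest {α : ℝ | Riccati.ContractsAtRate (Riccati.riccatiField A D S)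
        (Riccati.symOps 𝕜 E) (Riccati.posInvOps 𝕜 E) α} (sSup (Riccati.riccatiRates D S))) ∧
    -- positive semidefinite coefficients: the explicit formula
    ((∀ t, 0 ≤ t → (D t).IsPositive ∧ (S t).IsPositive) →
      Riccati.bestContractionRate (Riccati.riccatiField A D S)
          (Riccati.symOps 𝕜 E) (Riccati.posInvOps 𝕜 E) =
        ((2 * ⨅ t : Set.Ici (0 : ℝ), Real.sqrt (Riccati.lowerRatio
          (Riccati.opSqrt (S t) * D t * Riccati.opSqrt (S t)) (1 : E →L[𝕜] E)) : ℝ) : EReal) ∧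
      IsGreatest {α : ℝ | Riccati.ContractsAtRate (Riccati.riccatiField A D S)
          (Riccati.symOps 𝕜 E) (Riccati.posInvOps 𝕜 E) α}
        (2 * ⨅ t : Set.Ici (0 : ℝ), Real.sqrt (Riccati.lowerRatio
          (Riccati.opSqrt (S t) * D t * Riccati.opSqrt (S t)) (1 : E →L[𝕜] E)))) := by
  rw [Riccati.bestContractionRate,
    Riccati.contractsAtRate_iff hA hD hS hA_bdd hD_bdd hS_bdd hD_sym hS_sym]
  refine ⟨rfl, Riccati.isGreatest_sSup_riccatiRates hD_sym hS_sym, fun hpos => ?_⟩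
  have hgreatest := Riccati.riccatiRates_eq_Iic hpos hD_sym hS_sym ▸ isGreatest_Iic
  exact ⟨Riccati.coe_sSup_of_isGreatest hgreatest, hgreatest⟩
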